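/- **Setting.** Let $d\ge 1$, $0<\varepsilon\le 1/12$, and let $A=\mathrm{diag}(a_1,\dots,a_d)$ be a real diagonal matrix with $a_1\ge\cdots\ge a_d>0$, $2a_d\ge a_1$ and $\mathrm{Tr}\,A=d$. Let $G\sim\mathrm{GOE}(d)$, i.e. $G$ is a real symmetric $d\times d$ matrix whose entries on and above the diagonal are independent, $\mathcal N(0,2/d)$ on the diagonal and $\mathcal N(0,1/d)$ above it. Let $M=G-\frac{\mathrm{Tr}\,G}{d}I_d$, and let $\overline M$ have the law of $M$ conditioned on the event $U=\{\|M\|_{\mathrm{op}}\le 3,\ \|M\|_F^2\ge d/4\}$. Consider the two hypotheses $$H_0:\ \rho=\tfrac1d A,\qquad\qquad H_1:\ \rho=\tfrac1d\left(A+\varepsilon\overline M\right),$$ where under $H_1$ the matrix $\overline M$ is drawn once and all copies are in the same state. An algorithm that uses $n$ incoherent measurements is a tree $\mathcal T$ of depth $n$: each internal node, labelled by the outcomes $(x_1,\dots,x_t)$ observed so far, carries a POVM $\{E_z\}_z$ (a finite family of positive semidefinite complex $d\times d$ matrices with $\sum_z E_z=I_d$), which is applied to the next copy and gives outcome $z$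 with probability $\mathrm{Tr}(\rho E_z)$; at each leaf the algorithm outputs a (possibly randomized) guess in $\{H_0,H_1\}$. Let $p_0$ be the distribution of the leaf reached under $H_0$, and $p_1$ the one under $H_1$ (averaged over $\overline M$). **Theorem.** 1. There are absolute constants $c>0$ and $d_0$ such that, for all $d\ge d_0$ and all $\varepsilon$ and $A$ as above, every algorithm using $n$ incoherent measurements that guesses correctly with probability at least $2/3$ under $H_0$ and with probability at least $2/3$ under $H_1$ has $$n\ \ge\ c\,\frac{d^{3/2}}{\varepsilon^2}.$$ 2. The total variation distance between the leaf distributions is $o(1)$ whenever $n\ll d^{3/2}/\varepsilon^2$. That is, for every $\delta>0$ there are $c>0$ and $d_0$, depending only on $\delta$, such that for all $d\ge d_0$, all $\varepsilon$ and $A$ as above, all $n\le c\,d^{3/2}/\varepsilon^2$ and every tree $\mathcal T$ of depth $n$, $$d_{\mathrm{TV}}(p_0,p_1)=\tfrac12\sum_{x}|p_0(x)-p_1(x)|\ \le\ \delta.$$ -/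

import Mathlib

open MeasureTheory ProbabilityTheory
open scoped ComplexOrder

/-- A positive operator valued measurement on `ℂ^d` with outcomes in `Z`: a finite family of
positive semidefinite matrices summing to the identity. -/
structure POVM (d : ℕ) (Z : Type) [Fintype Z] where
  elem : Z → Matrix (Fin d) (Fin d) ℂ
  posSemidef : ∀ z, (elem z).PosSemidef
  sum_elem : ∑ z, elem z = 1

/-- The probability `Tr (ρ E_z)` of observing `z` when `ρ` is measured. -/
noncomputable def POVM.prob {d : ℕ} {Z : Type} [Fintype Z] (P : POVM d Z)
    (ρ : Matrix (Fin d) (Fin d) ℂ) (z : Z) : ℝ :=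
  (Matrix.trace (ρ * P.elem z)).re

/-- An adaptive strategy that makes `n` incoherent measurements, as a tree of depth `n`: the nodes
at depth `t` are the strings of `t` outcomes, and each internal node carries the POVM applied to the
next copy. POVM elements may vanish, so one finite set `Z` of outcome labels serves for all nodes;
rank-one POVMs `{ω_x d x x†}` are a special case. -/
structure LearningTree (d n : ℕ) (Z : Type) [Fintype Z] where
  povm : (t : Fin n) → (Fin t → Z) → POVM d Z

/-- The probability of reaching the leaf `x = (x_1, …, x_n)` when each copy is in the state `ρ`:
the product over the root-to-leaf path of the conditional outcome probabilities. -/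
noncomputable def LearningTree.leafProb {d n : ℕ} {Z : Type} [Fintype Z] (T : LearningTree d n Z)
    (ρ : Matrix (Fin d) (Fin d) ℂ) (x : Fin n → Z) : ℝ :=
  ∏ t : Fin n, (T.povm t fun j => x (Fin.castLE t.isLt.le j)).prob ρ (x t)

/-- Real matrices carry the product (Borel) sigma-algebra of their entries. -/
instance instMeasurableSpaceRealMatrix (m n : Type) : MeasurableSpace (Matrix m n ℝ) :=
  inferInstanceAs (MeasurableSpace (m → n → ℝ))

/-- The law of `GOE(d)`: real symmetric `d × d` matrices with independent entries on and above the
diagonal, `N(0, 2/d)` on it and `N(0, 1/d)` off it. The independent entries are indexed by the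
unordered pairs `{i, j}`. -/
noncomputable def goe (d : ℕ) : Measure (Matrix (Fin d) (Fin d) ℝ) :=
  (Measure.pi fun p : Sym2 (Fin d) =>
    gaussianReal 0 (if p.IsDiag then 2 / (d : NNReal) else 1 / (d : NNReal))).map
    fun g => Matrix.of fun i j => g s(i, j)

/-- The law of a trace-centered GOE matrix `M = G - (Tr G / d) I`, where `G ∼ GOE(d)`. -/
noncomputable def goeStar (d : ℕ) : Measure (Matrix (Fin d) (Fin d) ℝ) :=
  (goe d).map fun G => G - (G.trace / (d : ℝ)) • (1 : Matrix (Fin d) (Fin d) ℝ)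

/-- The truncation event `‖M‖_op ≤ 3` and `‖M‖_F² ≥ d / 4`. -/
def truncationSet (d : ℕ) : Set (Matrix (Fin d) (Fin d) ℝ) :=
  {M | ‖Matrix.toEuclideanCLM (n := Fin d) (𝕜 := ℝ) M‖ ≤ 3 ∧
    (d : ℝ) / 4 ≤ ∑ i, ∑ j, M i j ^ 2}

/-- The law of a truncated trace-centered GOE matrix: `goeStar d` conditioned on `truncationSet d`. -/
noncomputable def truncatedGoeStar (d : ℕ) : Measure (Matrix (Fin d) (Fin d) ℝ) :=
  ProbabilityTheory.cond (goeStar d) (truncationSet d)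

/-- The state `(A + ε M) / d`, where `A` is diagonal with entries `a`. -/
noncomputable def perturbedState {d : ℕ} (a : Fin d → ℝ) (ε : ℝ) (M : Matrix (Fin d) (Fin d) ℝ) :
    Matrix (Fin d) (Fin d) ℂ :=
  ((1 / (d : ℝ)) • (Matrix.diagonal a + ε • M)).map fun r : ℝ => (r : ℂ)

/-- The null hypothesis `ρ = A / d`. -/
noncomputable def nullState {d : ℕ} (a : Fin d → ℝ) : Matrix (Fin d) (Fin d) ℂ :=
  ((1 / (d : ℝ)) • Matrix.diagonal a).map fun r : ℝ => (r : ℂ)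

/-- The leaf distribution `p₀` under the null hypothesis. -/
noncomputable def LearningTree.nullDist {d n : ℕ} {Z : Type} [Fintype Z] (T : LearningTree d n Z)
    (a : Fin d → ℝ) (x : Fin n → Z) : ℝ :=
  T.leafProb (nullState a) x

/-- The leaf distribution `p₁` under the alternative hypothesis: all `n` copies are in the same
random state `(A + ε M) / d`, and `M` is a truncated trace-centered GOE matrix. -/
noncomputable def LearningTree.altDist {d n : ℕ} {Z : Type} [Fintype Z] (T : LearningTree d n Z)
    (a : Fin d → ℝ) (ε : ℝ) (x : Fin n → Z) : ℝ :=
  ∫ M, T.leafProb (perturbedState a ε M) x ∂(truncatedGoeStar d)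

/-- Total variation distance of two distributions on a finite set, given by their probabilities. -/
noncomputable def tvDist {S : Type} [Fintype S] (p q : S → ℝ) : ℝ :=
  (1 / 2) * ∑ x, |p x - q x|

/-- The algorithm that runs `T` and at the leaf `x` answers "alternative" with probability `φ x` and
"null" with probability `1 - φ x` succeeds with probability at least `2 / 3` under each of the two
hypotheses. -/
def LearningTree.Distinguishes {d n : ℕ} {Z : Type} [Fintype Z]
    (T : LearningTree d n Z) (a : Fin d → ℝ) (ε : ℝ) (φ : (Fin n → Z) → ℝ) : Prop :=
  (∀ x, 0 ≤ φ x ∧ φ x ≤ 1) ∧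
    2 / 3 ≤ ∑ x, T.nullDist a x * (1 - φ x) ∧
    2 / 3 ≤ ∑ x, T.altDist a ε x * φ x

/-- The reference matrix `A = diag(a_1, …, a_d)`: `a_1 ≥ ⋯ ≥ a_d > 0`, `2 a_d ≥ a_1` and
`Tr A = d`. -/
structure IsReference {d : ℕ} (a : Fin d → ℝ) : Prop where
  antitone : Antitone a
  pos : ∀ i, 0 < a i
  comparable : ∀ i j, a i ≤ 2 * a j
  trace_eq : ∑ i, a i = d

/-! Let `y_t` be the real part of the POVM element observed at step `t`, divided by its pairing with
`A`; since `A ≥ 1/2`, its trace is at most `2`. Given `M`, the likelihood ratio of a leaf is `∏ (1 +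
ε⟨M, y_t⟩)`; let `L` be its mean over the truncated law. As `p₀` and `p₁ = p₀ L` both have mass one,
the total variation distance is the `p₀`-mean of the positive part of `1 - L`. So a lower bound for
`L` along each path is enough, and no second moment of `L` enters.

Let `c_t` be the trace-free part of `y_t` and `S = ∑ c_t`. The trace-centered GOE is Gaussian with
density proportional to `exp(-(d/4)‖M‖²)` on trace-free symmetric matrices. Translate it by `H =
(2ε/d) S`, which maximizes `ε⟨H, S⟩ - (d/4)‖H‖²`, and apply Jensen's inequality to the exponential
on a typical set that is invariant under `M ↦ -M`, so that terms linear in `M` average to zero. The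
translation gains `(ε²/d)‖S‖²`, and the quadratic term of the logarithm loses about `(ε²/2) ∑ E⟨M,
c_t⟩² = (ε²/d) ∑ ‖c_t‖²`. Up to small errors the exponent is `(ε²/d)(‖S‖² - ∑ ‖c_t‖²)`: only cross
terms survive (`le_lintegral_likelihood`).

Under `p₀` the `c_t` are martingale differences, because the mean of `y_t` is `I/d`, and their
conditional covariance is at most `2/d`, because POVM elements sum to `I`. Hence the cross terms
have second moment `O(n²/d)` (`IsTreeMartingale.mean_crossTerm_sq_le`), and the mean deficit of `L`
is `O(n ε² / d^{3/2})` plus the `O(1/d)` probability of atypical matrices.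

The typical set (`‖M‖ ≤ 29/10`, `‖M‖_F² ≥ d/2`) leaves room for a translation of Frobenius norm at
most `1/10` to stay inside the truncation event; paths on which `S` is too long are handled by
Markov's inequality. -/

/-! ### Product Gaussian measures: translation, moments, Jensen's inequality. -/

section Gaussian

/-- Completing the square. The sign is such that adding `h` afterwards recenters the tilted law. -/
lemma gaussianReal_withDensity_tilt (h : ℝ) {v : NNReal} (hv : v ≠ 0) :
    (gaussianReal 0 v).withDensity
      (fun x => ENNReal.ofReal (Real.exp (-(h * x / v) - h ^ 2 / (2 * v)))) =
      gaussianReal (-h) v := by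
  rw [gaussianReal_of_var_ne_zero _ hv, gaussianReal_of_var_ne_zero _ hv,
    ← withDensity_mul _ (measurable_gaussianPDF _ _) (by fun_prop)]
  congr 1
  ext x
  have hv' : (v : ℝ) ≠ 0 := by exact_mod_cast hv
  simp only [Pi.mul_apply, gaussianPDF, gaussianPDFReal]
  rw [← ENNReal.ofReal_mul (by positivity), mul_assoc, ← Real.exp_add]
  congr 3
  field_simp
  ring

/-- It suffices to compare on boxes, where the integral factorizes because the coordinates are
independent. -/
lemma pi_withDensity {ι : Type*} [Fintype ι] (μ : ι → Measure ℝ) [∀ i, IsProbabilityMeasure (μ i)]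
    (f : ι → ℝ → ENNReal) (hf : ∀ i, Measurable (f i))
    [∀ i, SigmaFinite ((μ i).withDensity (f i))] :
    (Measure.pi μ).withDensity (fun g => ∏ i, f i (g i)) =
      Measure.pi fun i => (μ i).withDensity (f i) := by
  symm
  refine Measure.pi_eq fun s hs => ?_
  rw [withDensity_apply _ (MeasurableSet.univ_pi hs), ← lintegral_indicator (MeasurableSet.univ_pi hs)]
  have h1 : (Set.univ.pi s).indicator (fun g : ι → ℝ => ∏ i, f i (g i)) =
      fun g => ∏ i, (s i).indicator (f i) (g i) := by
    ext g
    by_cases hg : g ∈ Set.univ.pi s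
    · rw [Set.indicator_of_mem hg]
      exact Finset.prod_congr rfl fun i _ => by
        rw [Set.indicator_of_mem (hg i (Set.mem_univ i))]
    · rw [Set.indicator_of_notMem hg]
      simp only [Set.mem_pi, Set.mem_univ, true_implies, not_forall] at hg
      obtain ⟨i, hi⟩ := hg
      exact (Finset.prod_eq_zero (Finset.mem_univ i) (Set.indicator_of_notMem hi _)).symm
  have hm : ∀ i, Measurable ((s i).indicator (f i)) := fun i => (hf i).indicator (hs i)
  have hind := iIndepFun_pi (μ := μ) (X := fun i => (s i).indicator (f i))
    (fun i => (hm i).aemeasurable)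
  rw [h1]
  have := lintegral_prod_eq_prod_lintegral_of_indepFun Finset.univ
    (fun i (g : ι → ℝ) => (s i).indicator (f i) (g i)) hind
    (fun i => (hm i).comp (measurable_pi_apply i))
  rw [this]
  refine Finset.prod_congr rfl fun i _ => ?_
  rw [withDensity_apply _ (hs i), ← lintegral_indicator (hs i)]
  exact (measurePreserving_eval μ i).lintegral_comp (hm i)

/-- Translation formula for a product of centered Gaussians. -/
lemma lintegral_pi_gaussian_shift {ι : Type*} [Fintype ι] (v : ι → NNReal) (hv : ∀ i, v i ≠ 0)
    (h : ι → ℝ) (f : (ι → ℝ) → ENNReal) (hf : Measurable f) :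
    ∫⁻ g, f g ∂(Measure.pi fun i => gaussianReal 0 (v i)) =
      ∫⁻ g, ENNReal.ofReal (Real.exp (∑ i, (-(h i * g i / v i) - h i ^ 2 / (2 * v i)))) * f (g + h)
        ∂(Measure.pi fun i => gaussianReal 0 (v i)) := by
  have hσ : ∀ i, SigmaFinite ((gaussianReal 0 (v i)).withDensity
      (fun x => ENNReal.ofReal (Real.exp (-(h i * x / v i) - h i ^ 2 / (2 * v i))))) := by
    intro i
    rw [gaussianReal_withDensity_tilt (h i) (hv i)]
    infer_instance
  have h1 := pi_withDensity (fun i => gaussianReal 0 (v i))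
    (fun i x => ENNReal.ofReal (Real.exp (-(h i * x / v i) - h i ^ 2 / (2 * v i))))
    (fun i => by fun_prop)
  simp_rw [fun i => gaussianReal_withDensity_tilt (h i) (hv i)] at h1
  -- The tilted product measure has means `-h`; translating it by `h` recovers the centered one.
  have h2 : (Measure.pi fun i => gaussianReal 0 (v i)) =
      (Measure.pi fun i => gaussianReal (-h i) (v i)).map (fun g => g + h) := by
    have := Measure.pi_map_pi (μ := fun i => gaussianReal (-h i) (v i)) (f := fun i x => x + h i)
      (hμ := fun i => by rw [gaussianReal_map_add_const]; infer_instance)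
      (fun i => by fun_prop)
    simp_rw [gaussianReal_map_add_const, neg_add_cancel] at this
    rw [← this]
    rfl
  conv_lhs => rw [h2]
  rw [lintegral_map hf (by fun_prop), ← h1, lintegral_withDensity_eq_lintegral_mul _ (by fun_prop)
    (show Measurable fun g => f (g + h) from hf.comp (by fun_prop))]
  refine lintegral_congr fun g => ?_
  simp only [Pi.mul_apply]
  rw [← ENNReal.ofReal_prod_of_nonneg (fun i _ => (Real.exp_pos _).le), ← Real.exp_sum]

variable {ι : Type*} [Fintype ι] (v : ι → NNReal) (c : ι → ℝ)

lemma integrable_exp_linear_pi :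
    Integrable (fun g : ι → ℝ => Real.exp (∑ i, c i * g i))
      (Measure.pi fun i => gaussianReal 0 (v i)) := by
  simp_rw [Real.exp_sum]
  exact Integrable.fintype_prod (f := fun i x => Real.exp (c i * x))
    (μ := fun i => gaussianReal 0 (v i)) fun i => integrable_exp_mul_gaussianReal (c i)

lemma integral_exp_linear_pi :
    ∫ g, Real.exp (∑ i, c i * g i) ∂(Measure.pi fun i => gaussianReal 0 (v i)) =
      Real.exp ((∑ i, c i ^ 2 * v i) / 2) := by
  simp_rw [Real.exp_sum]
  rw [integral_fintype_prod_eq_prod (f := fun i x => Real.exp (c i * x)), Finset.sum_div,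
    Real.exp_sum]
  refine Finset.prod_congr rfl fun i _ => ?_
  have := congrFun (mgf_id_gaussianReal (μ := 0) (v := v i)) (c i)
  simp only [mgf, id_eq] at this
  rw [this]
  congr 1
  ring

lemma memLp_eval_pi (i : ι) (p : ENNReal) (hp : p ≠ ⊤) :
    MemLp (fun g : ι → ℝ => g i) p (Measure.pi fun i => gaussianReal 0 (v i)) :=
  (memLp_id_gaussianReal' (μ := 0) (v := v i) p hp).comp_measurePreserving
    (measurePreserving_eval (fun i => gaussianReal 0 (v i)) i)

lemma memLp_linear_pi (p : ENNReal) (hp : p ≠ ⊤) :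
    MemLp (fun g : ι → ℝ => ∑ i, c i * g i) p (Measure.pi fun i => gaussianReal 0 (v i)) :=
  memLp_finsetSum _ fun i _ => (memLp_eval_pi v i p hp).const_mul (c i)

lemma integral_eval_pi (i : ι) :
    ∫ g, g i ∂(Measure.pi fun i => gaussianReal 0 (v i)) = 0 := by
  have := integral_comp_eval (μ := fun i => gaussianReal 0 (v i)) (i := i) (f := fun x : ℝ => x)
    (by fun_prop)
  rw [this, integral_id_gaussianReal]

lemma integral_linear_pi :
    ∫ g, ∑ i, c i * g i ∂(Measure.pi fun i => gaussianReal 0 (v i)) = 0 := by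
  rw [integral_finsetSum _ fun i _ => ((memLp_eval_pi v i 1 (by simp)).integrable le_rfl).const_mul _]
  simp [integral_const_mul, integral_eval_pi]

lemma integral_linear_sq_pi :
    ∫ g, (∑ i, c i * g i) ^ 2 ∂(Measure.pi fun i => gaussianReal 0 (v i)) =
      ∑ i, c i ^ 2 * v i := by
  have h1 := variance_of_integral_eq_zero
    (memLp_linear_pi v c 2 (by simp)).aestronglyMeasurable.aemeasurable (integral_linear_pi v c)
  have h2 := variance_sum_pi (μ := fun i => gaussianReal 0 (v i)) (X := fun i x => c i * x)
    fun i => (memLp_id_gaussianReal' (μ := 0) (v := v i) 2 (by simp)).const_mul (c i)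
  have h3 : (∑ i, fun g : ι → ℝ => c i * g i) = fun g => ∑ i, c i * g i := by
    ext g; simp
  rw [h3, h1] at h2
  rw [h2]
  refine Finset.sum_congr rfl fun i _ => ?_
  rw [variance_const_mul, variance_fun_id_gaussianReal]

lemma pow_four_le_exp_add_exp (x : ℝ) : x ^ 4 ≤ 24 * (Real.exp x + Real.exp (-x)) := by
  have h := Real.pow_div_factorial_le_exp (|x|) (abs_nonneg x) 4
  have h2 : Real.exp |x| ≤ Real.exp x + Real.exp (-x) := by
    rcases abs_cases x with ⟨h, _⟩ | ⟨h, _⟩ <;> rw [h] <;>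
      linarith [Real.exp_pos x, Real.exp_pos (-x)]
  have h3 : |x| ^ 4 = x ^ 4 := by
    rw [← abs_pow]; exact abs_of_nonneg (by positivity)
  rw [h3] at h
  norm_num [Nat.factorial] at h
  linarith

lemma integrable_linear_pow_four_pi :
    Integrable (fun g : ι → ℝ => (∑ i, c i * g i) ^ 4)
      (Measure.pi fun i => gaussianReal 0 (v i)) := by
  have := (memLp_linear_pi v c 4 (by simp)).integrable_norm_pow (by norm_num)
  refine this.congr (Filter.Eventually.of_forall fun g => ?_)
  simp only [Real.norm_eq_abs]
  rw [← abs_pow]; exact abs_of_nonneg (by positivity)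

/-- The bound `x⁴ ≤ 24 (eˣ + e⁻ˣ)` at scale `√s` reduces the moment to the Gaussian moment
generating function; the constant is `24 · 2 · 5/3` with `e^{1/2} ≤ 5/3`. -/
lemma integral_linear_pow_four_pi_le {s : ℝ} (hs : 0 < s) (h : ∑ i, c i ^ 2 * v i ≤ s) :
    ∫ g, (∑ i, c i * g i) ^ 4 ∂(Measure.pi fun i => gaussianReal 0 (v i)) ≤ 80 * s ^ 2 := by
  set τ := (Real.sqrt s)⁻¹ with hτ
  have hss : Real.sqrt s ^ 2 = s := Real.sq_sqrt hs.le
  have hsp : 0 < Real.sqrt s := Real.sqrt_pos.2 hs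
  have hb : ∀ g : ι → ℝ, (∑ i, c i * g i) ^ 4 ≤
      24 * s ^ 2 * (Real.exp (∑ i, (τ * c i) * g i) + Real.exp (∑ i, (-τ * c i) * g i)) := by
    intro g
    have := pow_four_le_exp_add_exp (τ * ∑ i, c i * g i)
    have e1 : τ * ∑ i, c i * g i = ∑ i, (τ * c i) * g i := by
      rw [Finset.mul_sum]; simp [mul_assoc]
    have e2 : -∑ i, (τ * c i) * g i = ∑ i, (-τ * c i) * g i := by
      rw [← Finset.sum_neg_distrib]; simp
    rw [mul_pow, e1, e2] at this
    have e3 : s ^ 2 * τ ^ 4 = 1 := by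
      rw [hτ, ← hss]; field_simp; rw [hss]
    calc (∑ i, c i * g i) ^ 4 = s ^ 2 * (τ ^ 4 * (∑ i, c i * g i) ^ 4) := by
          rw [← mul_assoc, e3, one_mul]
      _ ≤ s ^ 2 * (24 * (Real.exp (∑ i, (τ * c i) * g i) + Real.exp (∑ i, (-τ * c i) * g i))) := by
          gcongr
      _ = _ := by ring
  have hI1 := integrable_exp_linear_pi v (fun i => τ * c i)
  have hI2 := integrable_exp_linear_pi v (fun i => -τ * c i)
  refine (integral_mono (integrable_linear_pow_four_pi v c)
    ((hI1.add hI2).const_mul (24 * s ^ 2)) hb).trans ?_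
  simp only [Pi.add_apply]
  rw [integral_const_mul, integral_add hI1 hI2, integral_exp_linear_pi, integral_exp_linear_pi]
  have e4 : ∑ i, (τ * c i) ^ 2 * (v i : ℝ) ≤ 1 := by
    have : ∑ i, (τ * c i) ^ 2 * (v i : ℝ) = s⁻¹ * ∑ i, c i ^ 2 * v i := by
      rw [Finset.mul_sum]
      refine Finset.sum_congr rfl fun i _ => ?_
      rw [mul_pow, hτ, inv_pow, hss]; ring
    rw [this, inv_mul_le_iff₀ hs]; simpa using h
  have e5 : ∑ i, (-τ * c i) ^ 2 * (v i : ℝ) = ∑ i, (τ * c i) ^ 2 * (v i : ℝ) := by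
    refine Finset.sum_congr rfl fun i _ => ?_
    ring
  rw [e5]
  have e6 : Real.exp ((∑ i, (τ * c i) ^ 2 * (v i : ℝ)) / 2) ≤ 5 / 3 := by
    have h1 : Real.exp ((∑ i, (τ * c i) ^ 2 * (v i : ℝ)) / 2) ≤ Real.exp (1 / 2) := by
      apply Real.exp_le_exp.2; linarith
    have h2 : Real.exp (1 / 2) ^ 2 = Real.exp 1 := by
      rw [← Real.exp_nat_mul]; norm_num
    have h3 := Real.exp_one_lt_d9
    have h4 := Real.exp_pos (1 / 2)
    nlinarith
  nlinarith [sq_nonneg s]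

/-- Jensen's inequality for the exponential, as a lower Lebesgue integral. -/
lemma ofReal_exp_integral_le_lintegral {Ω : Type*} [MeasurableSpace Ω] (μ : Measure Ω)
    [IsProbabilityMeasure μ] (φ : Ω → ℝ) (hφ : Integrable φ μ) :
    ENNReal.ofReal (Real.exp (∫ x, φ x ∂μ)) ≤ ∫⁻ x, ENNReal.ofReal (Real.exp (φ x)) ∂μ := by
  set m := ∫ x, φ x ∂μ with hm
  -- The tangent line of `exp` at the mean `m`. With a lower Lebesgue integral on the right,
  -- integrability of `exp ∘ φ` is not needed.
  have hI : Integrable (fun x => Real.exp m * (1 + (φ x - m))) μ :=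
    (((integrable_const _).add (hφ.sub (integrable_const _))).const_mul _)
  have h1 : ∫ x, Real.exp m * (1 + (φ x - m)) ∂μ = Real.exp m := by
    have hI' : Integrable (fun x => φ x - m) μ := hφ.sub (integrable_const _)
    rw [integral_const_mul, integral_add (integrable_const _) hI',
      integral_sub hφ (integrable_const _)]
    simp [hm]
  rw [← h1]
  refine (ENNReal.ofReal_le_of_le_toReal ?_ : ENNReal.ofReal _ ≤
    ∫⁻ x, ENNReal.ofReal (Real.exp m * (1 + (φ x - m))) ∂μ).trans ?_
  · rw [integral_eq_lintegral_pos_part_sub_lintegral_neg_part hI]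
    linarith [ENNReal.toReal_nonneg
      (a := ∫⁻ x, ENNReal.ofReal (-(Real.exp m * (1 + (φ x - m)))) ∂μ)]
  · refine lintegral_mono fun x => ENNReal.ofReal_le_ofReal ?_
    calc Real.exp m * (1 + (φ x - m)) ≤ Real.exp m * Real.exp (φ x - m) := by
          gcongr; linarith [Real.add_one_le_exp (φ x - m)]
      _ = Real.exp (φ x) := by rw [← Real.exp_add]; congr 1; ring

end Gaussian

/-! ### Frobenius geometry, centering, and the operator norm of symmetric matrices. -/

section Frobenius

open Matrix

variable {d : ℕ}

/-- The Frobenius inner product of real matrices. -/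
def frob (X Y : Matrix (Fin d) (Fin d) ℝ) : ℝ := ∑ i, ∑ j, X i j * Y i j

/-- The projection of a matrix onto the matrices of trace zero. -/
noncomputable def center (X : Matrix (Fin d) (Fin d) ℝ) : Matrix (Fin d) (Fin d) ℝ :=
  X - (X.trace / (d : ℝ)) • (1 : Matrix (Fin d) (Fin d) ℝ)

lemma frob_comm (X Y : Matrix (Fin d) (Fin d) ℝ) : frob X Y = frob Y X := by
  simp [frob, mul_comm]

lemma frob_add_left (X Y Z : Matrix (Fin d) (Fin d) ℝ) :
    frob (X + Y) Z = frob X Z + frob Y Z := by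
  simp [frob, add_mul, Finset.sum_add_distrib]

lemma frob_sub_left (X Y Z : Matrix (Fin d) (Fin d) ℝ) :
    frob (X - Y) Z = frob X Z - frob Y Z := by
  simp [frob, sub_mul, Finset.sum_sub_distrib]

lemma frob_smul_left (r : ℝ) (X Y : Matrix (Fin d) (Fin d) ℝ) :
    frob (r • X) Y = r * frob X Y := by
  simp [frob, Finset.mul_sum, mul_assoc]

lemma frob_add_right (X Y Z : Matrix (Fin d) (Fin d) ℝ) :
    frob X (Y + Z) = frob X Y + frob X Z := by
  rw [frob_comm, frob_add_left, frob_comm Y, frob_comm Z]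

lemma frob_sub_right (X Y Z : Matrix (Fin d) (Fin d) ℝ) :
    frob X (Y - Z) = frob X Y - frob X Z := by
  rw [frob_comm, frob_sub_left, frob_comm Y, frob_comm Z]

lemma frob_smul_right (r : ℝ) (X Y : Matrix (Fin d) (Fin d) ℝ) :
    frob X (r • Y) = r * frob X Y := by
  rw [frob_comm, frob_smul_left, frob_comm]

lemma frob_sum_right {α : Type*} (s : Finset α) (X : Matrix (Fin d) (Fin d) ℝ)
    (Y : α → Matrix (Fin d) (Fin d) ℝ) : frob X (∑ t ∈ s, Y t) = ∑ t ∈ s, frob X (Y t) := by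
  simp only [frob, Matrix.sum_apply, Finset.mul_sum]
  rw [Finset.sum_comm (s := s)]
  exact Finset.sum_congr rfl fun i _ => Finset.sum_comm

lemma frob_self_nonneg (X : Matrix (Fin d) (Fin d) ℝ) : 0 ≤ frob X X :=
  Finset.sum_nonneg fun _ _ => Finset.sum_nonneg fun _ _ => mul_self_nonneg _

lemma frob_one_right (X : Matrix (Fin d) (Fin d) ℝ) : frob X 1 = X.trace := by
  simp [frob, Matrix.one_apply, Matrix.trace]

lemma frob_one_left (X : Matrix (Fin d) (Fin d) ℝ) : frob 1 X = X.trace := by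
  rw [frob_comm, frob_one_right]

lemma frob_sq_le (X Y : Matrix (Fin d) (Fin d) ℝ) : frob X Y ^ 2 ≤ frob X X * frob Y Y := by
  have h := Finset.sum_mul_sq_le_sq_mul_sq (Finset.univ : Finset (Fin d × Fin d))
    (fun p => X p.1 p.2) (fun p => Y p.1 p.2)
  simpa [frob, Fintype.sum_prod_type, sq] using h

lemma frob_eq_trace (X Y : Matrix (Fin d) (Fin d) ℝ) : frob X Y = (X * Yᵀ).trace := by
  simp [frob, Matrix.trace, Matrix.mul_apply]

lemma center_isSymm {X : Matrix (Fin d) (Fin d) ℝ} (hX : X.IsSymm) : (center X).IsSymm := by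
  unfold center
  exact hX.sub (Matrix.isSymm_one.smul _)

/-- Centering is an orthogonal projection, hence self-adjoint; it can be moved from the random
matrix to the POVM element. -/
lemma frob_center_left (X Y : Matrix (Fin d) (Fin d) ℝ) :
    frob (center X) Y = frob X (center Y) := by
  rw [center, center, frob_sub_left, frob_sub_right, frob_smul_left, frob_smul_right,
    frob_one_left, frob_one_right]
  ring

lemma center_of_trace_eq_zero {X : Matrix (Fin d) (Fin d) ℝ} (h : X.trace = 0) : center X = X := by
  simp [center, h]

lemma trace_center (X : Matrix (Fin d) (Fin d) ℝ) : (center X).trace = 0 := by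
  rcases Nat.eq_zero_or_pos d with rfl | hd
  · simp [Matrix.trace]
  · have : (d : ℝ) ≠ 0 := by positivity
    simp [center, this]

lemma center_center (X : Matrix (Fin d) (Fin d) ℝ) : center (center X) = center X :=
  center_of_trace_eq_zero (trace_center X)

lemma center_add (X Y : Matrix (Fin d) (Fin d) ℝ) : center (X + Y) = center X + center Y := by
  simp only [center, Matrix.trace_add, add_div, add_smul]; abel

lemma center_smul (r : ℝ) (X : Matrix (Fin d) (Fin d) ℝ) : center (r • X) = r • center X := by
  simp only [center, Matrix.trace_smul, smul_sub, smul_smul, smul_eq_mul, mul_div_assoc]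

lemma center_neg (X : Matrix (Fin d) (Fin d) ℝ) : center (-X) = -center X := by
  simpa using center_smul (-1) X

lemma frob_center_self_le (X : Matrix (Fin d) (Fin d) ℝ) :
    frob (center X) (center X) ≤ frob X X := by
  have h : frob X X = frob (center X) (center X) + frob (X - center X) (X - center X) := by
    have h0 : frob (center X) (center X) = frob X (center X) := by
      rw [frob_center_left, center_center]
    simp only [frob_sub_left, frob_sub_right, frob_comm (center X) X]
    rw [h0]; ring
  linarith [frob_self_nonneg (X - center X)]

lemma dotProduct_mulVec_eq_frob (M : Matrix (Fin d) (Fin d) ℝ) (x : Fin d → ℝ) :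
    x ⬝ᵥ M *ᵥ x = frob M (vecMulVec x x) := by
  simp only [dotProduct, mulVec, frob, vecMulVec_apply, Finset.mul_sum]
  exact Finset.sum_congr rfl fun i _ => Finset.sum_congr rfl fun j _ => by ring

lemma frob_vecMulVec_self (x : Fin d → ℝ) :
    frob (vecMulVec x x) (vecMulVec x x) = (x ⬝ᵥ x) ^ 2 := by
  simp only [dotProduct, frob, vecMulVec_apply, sq, Finset.sum_mul_sum]
  exact Finset.sum_congr rfl fun i _ => Finset.sum_congr rfl fun j _ => by ring

lemma dotProduct_self_nonneg' (x : Fin d → ℝ) : 0 ≤ x ⬝ᵥ x :=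
  Finset.sum_nonneg fun _ _ => mul_self_nonneg _

/-- Cauchy–Schwarz against `vecMulVec x x`: the operator norm is at most the Frobenius norm. -/
lemma abs_dotProduct_mulVec_le_of_frob {M : Matrix (Fin d) (Fin d) ℝ} {r : ℝ} (hr : 0 ≤ r)
    (h : frob M M ≤ r ^ 2) (x : Fin d → ℝ) : |x ⬝ᵥ M *ᵥ x| ≤ r * (x ⬝ᵥ x) := by
  apply abs_le_of_sq_le_sq _ (mul_nonneg hr (dotProduct_self_nonneg' x))
  rw [dotProduct_mulVec_eq_frob, mul_pow, ← frob_vecMulVec_self]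
  exact (frob_sq_le _ _).trans (mul_le_mul_of_nonneg_right h (frob_self_nonneg _))

/-- The norm of a symmetric operator is the supremum of its Rayleigh quotients. Quadratic-form
inequalities are then used everywhere, since they add up under translation. -/
lemma norm_toEuclideanCLM_le_iff {M : Matrix (Fin d) (Fin d) ℝ} (hM : M.IsSymm) {t : ℝ}
    (ht : 0 ≤ t) :
    ‖Matrix.toEuclideanCLM (n := Fin d) (𝕜 := ℝ) M‖ ≤ t ↔
      ∀ x : Fin d → ℝ, |x ⬝ᵥ M *ᵥ x| ≤ t * (x ⬝ᵥ x) := by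
  set T := Matrix.toEuclideanCLM (n := Fin d) (𝕜 := ℝ) M with hT
  have hin : ∀ x y : EuclideanSpace ℝ (Fin d), inner ℝ (T x) y = y.ofLp ⬝ᵥ M *ᵥ x.ofLp := by
    intro x y
    rw [EuclideanSpace.inner_eq_star_dotProduct]
    simp [hT, Matrix.ofLp_toEuclideanCLM]
  have hnorm : ∀ x : EuclideanSpace ℝ (Fin d), ‖x‖ ^ 2 = x.ofLp ⬝ᵥ x.ofLp := by
    intro x
    rw [EuclideanSpace.real_norm_sq_eq]; simp [dotProduct, sq]
  have hsymm : T.IsSymmetric := by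
    intro x y
    have h1 : inner ℝ x (T y) = inner ℝ (T y) x := real_inner_comm _ _
    simp only [ContinuousLinearMap.coe_coe]
    rw [h1, hin, hin, Matrix.dotProduct_mulVec, dotProduct_comm, ← Matrix.mulVec_transpose, hM]
  have key : ∀ x : EuclideanSpace ℝ (Fin d), |T.rayleighQuotient x| * ‖x‖ ^ 2 =
      |x.ofLp ⬝ᵥ M *ᵥ x.ofLp| := by
    intro x
    rw [← hin]
    by_cases hx : x = 0
    · subst hx; simp
    · have : ‖x‖ ^ 2 ≠ 0 := by positivity
      rw [ContinuousLinearMap.rayleighQuotient, ContinuousLinearMap.reApplyInnerSelf, abs_div,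
        abs_of_nonneg (sq_nonneg ‖x‖), div_mul_cancel₀ _ this]
      simp
  constructor
  · intro h x
    have h1 := T.rayleighQuotient_le_norm (WithLp.toLp 2 x)
    have h2 := key (WithLp.toLp 2 x)
    simp only at h2
    rw [← h2, hnorm]
    exact mul_le_mul_of_nonneg_right (h1.trans h) (dotProduct_self_nonneg' x)
  · intro h
    rw [T.norm_eq_iSup_rayleighQuotient hsymm]
    refine ciSup_le fun x => ?_
    by_cases hx : x = 0
    · subst hx; simpa using ht
    · have h0 : 0 < ‖x‖ ^ 2 := by positivity
      refine le_of_mul_le_mul_right ?_ h0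
      rw [key, hnorm]
      exact h _

end Frobenius

/-! ### The GOE in its independent entries. -/

section Goe

variable {d : ℕ}

/-- The symmetric matrix with independent entries `g` on and above the diagonal. -/
def symMat (g : Sym2 (Fin d) → ℝ) : Matrix (Fin d) (Fin d) ℝ := Matrix.of fun i j => g s(i, j)

/-- The entry of the symmetric part of `X` at an unordered pair. -/
noncomputable def entry (X : Matrix (Fin d) (Fin d) ℝ) : Sym2 (Fin d) → ℝ :=
  Sym2.lift ⟨fun i j => (X i j + X j i) / 2, fun i j => by simp only [add_comm]⟩

lemma entry_mk {X : Matrix (Fin d) (Fin d) ℝ} (hX : X.IsSymm) (i j : Fin d) :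
    entry X s(i, j) = X i j := by
  have := hX.apply i j
  simp only [entry, Sym2.lift_mk]
  rw [this]; ring

/-- The number of matrix positions that carry an unordered pair. -/
def symMult (p : Sym2 (Fin d)) : ℝ := if p.IsDiag then 1 else 2

lemma symMult_pos (p : Sym2 (Fin d)) : 0 < symMult p := by
  unfold symMult; split_ifs <;> norm_num

lemma sum_sum_sym2 (F : Sym2 (Fin d) → ℝ) :
    ∑ i, ∑ j, F s(i, j) = ∑ p, symMult p * F p := by
  rw [← Fintype.sum_prod_type' (f := fun i j => F s(i, j)),
    ← Finset.sum_fiberwise (s := Finset.univ) (g := fun q : Fin d × Fin d => s(q.1, q.2))]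
  refine Finset.sum_congr rfl fun p _ => ?_
  rw [Finset.sum_congr rfl (g := fun _ => F p)
    (fun q hq => by rw [← (Finset.mem_filter.1 hq).2]), Finset.sum_const, nsmul_eq_mul]
  congr 1
  induction p with
  | _ a b =>
    have h : (Finset.univ.filter fun q : Fin d × Fin d => s(q.1, q.2) = s(a, b)) =
        {(a, b), (b, a)} := by
      ext ⟨x, y⟩
      simp
    rw [h]
    by_cases hab : a = b
    · subst hab; simp [symMult]
    · have : (a, b) ≠ (b, a) := by simp [hab]
      rw [Finset.card_pair this]; simp [symMult, hab]

/-- The variances of the independent entries of a GOE matrix. -/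
noncomputable def goeVar (d : ℕ) (p : Sym2 (Fin d)) : NNReal :=
  if p.IsDiag then 2 / (d : NNReal) else 1 / (d : NNReal)

/-- The law of the independent entries of a GOE matrix. -/
noncomputable abbrev goeEntries (d : ℕ) : Measure (Sym2 (Fin d) → ℝ) :=
  Measure.pi fun p => gaussianReal 0 (goeVar d p)

/-- The variance of an entry is inversely proportional to its multiplicity. Multiplicities therefore
cancel and the GOE is isotropic for `frob`: linear functionals have variance `2/d` times a squared
norm, and translations cost `d/4` times one. -/
lemma goeVar_eq (p : Sym2 (Fin d)) : (goeVar d p : ℝ) = 2 / d / symMult p := by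
  unfold goeVar symMult
  split_ifs
  · simp
  · simp only [NNReal.coe_div, NNReal.coe_one, NNReal.coe_natCast]; ring

lemma goeVar_ne_zero (hd : 0 < d) (p : Sym2 (Fin d)) : goeVar d p ≠ 0 := by
  have : (d : NNReal) ≠ 0 := by positivity
  unfold goeVar; split_ifs <;> simp [this]

/-- The trace-centered GOE matrix with independent entries `g`. -/
noncomputable def goeMat (g : Sym2 (Fin d) → ℝ) : Matrix (Fin d) (Fin d) ℝ := center (symMat g)

lemma symMat_isSymm (g : Sym2 (Fin d) → ℝ) : (symMat g).IsSymm :=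
  Matrix.IsSymm.ext fun i j => by simp [symMat, Sym2.eq_swap]

lemma goeMat_isSymm (g : Sym2 (Fin d) → ℝ) : (goeMat g).IsSymm := center_isSymm (symMat_isSymm g)

lemma trace_goeMat (g : Sym2 (Fin d) → ℝ) : (goeMat g).trace = 0 := trace_center _

/-- The coefficients of `frob (goeMat g) X` as a linear functional of `g`. -/
noncomputable def goeCoeff (X : Matrix (Fin d) (Fin d) ℝ) (p : Sym2 (Fin d)) : ℝ :=
  symMult p * entry (center X) p

lemma frob_goeMat {X : Matrix (Fin d) (Fin d) ℝ} (hX : X.IsSymm) (g : Sym2 (Fin d) → ℝ) :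
    frob (goeMat g) X = ∑ p, goeCoeff X p * g p := by
  rw [goeMat, frob_center_left]
  simp only [goeCoeff, mul_assoc]
  rw [← sum_sum_sym2 fun p => entry (center X) p * g p]
  simp only [entry_mk (center_isSymm hX), frob, symMat, Matrix.of_apply, mul_comm]

lemma sum_goeCoeff_sq {X : Matrix (Fin d) (Fin d) ℝ} (hX : X.IsSymm) :
    ∑ p, goeCoeff X p ^ 2 * (goeVar d p : ℝ) = 2 / d * frob (center X) (center X) := by
  have h : ∀ p, goeCoeff X p ^ 2 * (goeVar d p : ℝ) =
      2 / d * (symMult p * (entry (center X) p * entry (center X) p)) := by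
    intro p
    have := (symMult_pos p).ne'
    rw [goeCoeff, goeVar_eq]
    field_simp
  simp_rw [h]
  rw [← Finset.mul_sum, ← sum_sum_sym2]
  simp only [entry_mk (center_isSymm hX), frob]

lemma symMat_add (g h : Sym2 (Fin d) → ℝ) : symMat (g + h) = symMat g + symMat h := rfl

lemma symMat_entry {X : Matrix (Fin d) (Fin d) ℝ} (hX : X.IsSymm) : symMat (entry X) = X := by
  ext i j; simp [symMat, entry_mk hX]

lemma goeMat_add_entry {H : Matrix (Fin d) (Fin d) ℝ} (hH : H.IsSymm) (htr : H.trace = 0)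
    (g : Sym2 (Fin d) → ℝ) : goeMat (g + entry H) = goeMat g + H := by
  rw [goeMat, symMat_add, center_add, symMat_entry hH, center_of_trace_eq_zero htr, goeMat]

lemma goeMat_neg (g : Sym2 (Fin d) → ℝ) : goeMat (-g) = -goeMat g := by
  rw [goeMat, goeMat, ← center_neg]; rfl

/-- Trace zero of `H` allows the pairing with the uncentered matrix to be replaced by a pairing with
`goeMat g`. -/
lemma sum_shift_exponent (hd : 0 < d) {H : Matrix (Fin d) (Fin d) ℝ} (hH : H.IsSymm)
    (htr : H.trace = 0) (g : Sym2 (Fin d) → ℝ) :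
    ∑ p, (-(entry H p * g p / goeVar d p) - entry H p ^ 2 / (2 * goeVar d p)) =
      -(d / 2 * frob (goeMat g) H) - d / 4 * frob H H := by
  have hd' : (d : ℝ) ≠ 0 := by positivity
  have h : ∀ p, -(entry H p * g p / goeVar d p) - entry H p ^ 2 / (2 * goeVar d p) =
      symMult p * (-(d / 2 * (entry H p * g p)) - d / 4 * (entry H p * entry H p)) := by
    intro p
    have := (symMult_pos p).ne'
    rw [goeVar_eq]
    field_simp
    ring
  simp_rw [h]
  rw [← sum_sum_sym2, goeMat, frob_center_left, center_of_trace_eq_zero htr]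
  simp only [entry_mk hH, frob, symMat, Matrix.of_apply, Finset.sum_sub_distrib,
    Finset.sum_neg_distrib, Finset.mul_sum]
  simp only [mul_comm (H _ _) (g _)]

end Goe

/-! ### Inequalities for positive semidefinite matrices, and real parts. -/

section PosSemidef

open Matrix

variable {d : ℕ}

lemma exists_transpose_mul_self {B : Matrix (Fin d) (Fin d) ℝ} (hB : B.PosSemidef) :
    ∃ C : Matrix (Fin d) (Fin d) ℝ, B = Cᵀ * C := by
  open scoped MatrixOrder in
  obtain ⟨C, hC⟩ := CStarAlgebra.nonneg_iff_eq_star_mul_self.1 hB.nonneg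
  exact ⟨C, by rw [hC, Matrix.star_eq_conjTranspose, Matrix.conjTranspose_eq_transpose_of_trivial]⟩

lemma frob_transpose_mul_self (M C : Matrix (Fin d) (Fin d) ℝ) :
    frob M (Cᵀ * C) = ∑ k, C k ⬝ᵥ M *ᵥ C k := by
  have h : Cᵀ * C = ∑ k, vecMulVec (C k) (C k) := by
    ext i j
    simp [Matrix.mul_apply, Matrix.sum_apply, vecMulVec_apply]
  rw [h, frob_sum_right]
  simp_rw [dotProduct_mulVec_eq_frob]

lemma trace_transpose_mul_self (C : Matrix (Fin d) (Fin d) ℝ) :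
    (Cᵀ * C).trace = ∑ k, C k ⬝ᵥ C k := by
  rw [← frob_one_left, frob_transpose_mul_self]
  simp

lemma Matrix.PosSemidef.abs_frob_le {B M : Matrix (Fin d) (Fin d) ℝ} (hB : B.PosSemidef) {t : ℝ}
    (hM : ∀ x : Fin d → ℝ, |x ⬝ᵥ M *ᵥ x| ≤ t * (x ⬝ᵥ x)) : |frob M B| ≤ t * B.trace := by
  obtain ⟨C, rfl⟩ := exists_transpose_mul_self hB
  rw [frob_transpose_mul_self, trace_transpose_mul_self, Finset.mul_sum]
  exact (Finset.abs_sum_le_sum_abs _ _).trans (Finset.sum_le_sum fun k _ => hM _)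

/-- With `B = CᵀC` one has `⟨v, B⟩ = ⟨C vᵀ, C⟩`; then Cauchy–Schwarz. This is linear in `B` up to
the trace factor, so it can be summed over a POVM. -/
lemma Matrix.PosSemidef.frob_sq_le_mul_trace {B : Matrix (Fin d) (Fin d) ℝ} (hB : B.PosSemidef)
    (v : Matrix (Fin d) (Fin d) ℝ) : frob v B ^ 2 ≤ frob (vᵀ * v) B * B.trace := by
  obtain ⟨C, rfl⟩ := exists_transpose_mul_self hB
  have h1 : frob v (Cᵀ * C) = frob (C * vᵀ) C := by
    rw [frob_eq_trace, frob_eq_trace, ← Matrix.trace_transpose (C * vᵀ * Cᵀ)]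
    simp only [Matrix.transpose_mul, Matrix.transpose_transpose]
    rw [← Matrix.mul_assoc, Matrix.trace_mul_comm]
  have h2 : frob (vᵀ * v) (Cᵀ * C) = frob (C * vᵀ) (C * vᵀ) := by
    rw [frob_eq_trace, frob_eq_trace]
    simp only [Matrix.transpose_mul, Matrix.transpose_transpose]
    rw [← Matrix.mul_assoc, Matrix.trace_mul_comm]
    simp only [Matrix.mul_assoc]
  have h3 : (Cᵀ * C).trace = frob C C := by
    rw [frob_eq_trace, Matrix.trace_mul_comm]
  rw [h1, h2, h3]
  exact frob_sq_le _ _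

lemma Matrix.PosSemidef.frob_self_le_trace_sq {B : Matrix (Fin d) (Fin d) ℝ} (hB : B.PosSemidef) :
    frob B B ≤ B.trace ^ 2 := by
  obtain ⟨C, rfl⟩ := exists_transpose_mul_self hB
  have h : ∀ i j, (Cᵀ * C) i j * (Cᵀ * C) i j ≤ (Cᵀ * C) i i * (Cᵀ * C) j j := by
    intro i j
    have := Finset.sum_mul_sq_le_sq_mul_sq Finset.univ (fun k => C k i) (fun k => C k j)
    simpa [Matrix.mul_apply, sq] using this
  calc frob (Cᵀ * C) (Cᵀ * C) ≤ ∑ i, ∑ j, (Cᵀ * C) i i * (Cᵀ * C) j j :=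
        Finset.sum_le_sum fun i _ => Finset.sum_le_sum fun j _ => h i j
    _ = _ := by rw [sq, Matrix.trace, Finset.sum_mul_sum]; rfl

/-- The real part of a complex positive semidefinite matrix. -/
def rePart (E : Matrix (Fin d) (Fin d) ℂ) : Matrix (Fin d) (Fin d) ℝ := E.map Complex.re

lemma rePart_posSemidef {E : Matrix (Fin d) (Fin d) ℂ} (hE : E.PosSemidef) :
    (rePart E).PosSemidef := by
  refine .of_dotProduct_mulVec_nonneg ?_ fun x => ?_
  · ext i j
    have := hE.1.apply i j
    simp [rePart, ← this]
  · have h := hE.dotProduct_mulVec_nonneg (fun i => (x i : ℂ))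
    have h1 := (Complex.le_def.1 h).1
    simpa [dotProduct, mulVec, rePart] using h1

/-- The states are real, so only the real part of a POVM element matters; it is symmetric because
the element is Hermitian, which absorbs the transposition in the trace. -/
lemma re_trace_map_mul {E : Matrix (Fin d) (Fin d) ℂ} (hE : E.PosSemidef)
    (R : Matrix (Fin d) (Fin d) ℝ) :
    (Matrix.trace (R.map (fun r : ℝ => (r : ℂ)) * E)).re = frob R (rePart E) := by
  have hs := (rePart_posSemidef hE).1
  have : ∀ i j, (E j i).re = (rePart E) i j := fun i j => by
    have := hs.apply i j
    simpa [rePart] using this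
  simp [Matrix.trace, Matrix.mul_apply, frob, this]

end PosSemidef

/-! ### Moments of a shifted Gaussian vector. -/

section GaussianVector

open Matrix

variable {d : ℕ}

/-- The law of a vector with independent `N(0, 1/d)` coordinates. -/
noncomputable abbrev gaussianVector (d : ℕ) : Measure (Fin d → ℝ) :=
  Measure.pi fun _ => gaussianReal 0 (1 / (d : NNReal))

lemma integral_eval_mul_eval_gaussianVector (i j : Fin d) :
    ∫ w, w i * w j ∂(gaussianVector d) = if i = j then 1 / (d : ℝ) else 0 := by
  split_ifs with h
  · subst h
    have := integral_linear_sq_pi (fun _ : Fin d => 1 / (d : NNReal)) (Pi.single i 1)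
    simp only [Pi.single_apply, ite_mul, one_mul, zero_mul, ite_pow, one_pow, ne_eq,
      OfNat.ofNat_ne_zero, not_false_eq_true, zero_pow, Finset.sum_ite_eq', Finset.mem_univ,
      if_true] at this
    simpa only [sq, NNReal.coe_div, NNReal.coe_one, NNReal.coe_natCast, one_mul] using this
  · have hind := iIndepFun_pi (μ := fun _ : Fin d => gaussianReal 0 (1 / (d : NNReal)))
      (X := fun _ x => x) (fun _ => by fun_prop)
    have := (hind.indepFun h).integral_fun_mul_eq_mul_integral
      (memLp_eval_pi (fun _ : Fin d => 1 / (d : NNReal)) i 1 (by simp)).aestronglyMeasurable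
      (memLp_eval_pi (fun _ : Fin d => 1 / (d : NNReal)) j 1 (by simp)).aestronglyMeasurable
    rw [this, integral_eval_pi (fun _ : Fin d => 1 / (d : NNReal)) i, zero_mul]

lemma integrable_gaussianVector_eval (i : Fin d) :
    Integrable (fun w : Fin d → ℝ => w i) (gaussianVector d) :=
  (memLp_eval_pi (fun _ : Fin d => 1 / (d : NNReal)) i 1 (by simp)).integrable le_rfl

lemma integrable_gaussianVector_eval_mul (i j : Fin d) :
    Integrable (fun w : Fin d → ℝ => w i * w j) (gaussianVector d) :=
  (memLp_eval_pi (fun _ : Fin d => 1 / (d : NNReal)) i 2 (by simp)).integrable_mul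
    (memLp_eval_pi (fun _ : Fin d => 1 / (d : NNReal)) j 2 (by simp))

lemma integrable_shifted_entry (u : Fin d → ℝ) (i j : Fin d) :
    Integrable (fun w : Fin d → ℝ => (w i + u i) * (w j + u j)) (gaussianVector d) := by
  have h : (fun w : Fin d → ℝ => (w i + u i) * (w j + u j)) =
      fun w => w i * w j + (u j * w i + u i * w j) + u i * u j := by ext w; ring
  rw [h]
  exact ((integrable_gaussianVector_eval_mul i j).add
    (((integrable_gaussianVector_eval i).const_mul _).add
      ((integrable_gaussianVector_eval j).const_mul _))).add (integrable_const _)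

lemma integral_shifted_entry (u : Fin d → ℝ) (i j : Fin d) :
    ∫ w, (w i + u i) * (w j + u j) ∂(gaussianVector d) =
      (if i = j then 1 / (d : ℝ) else 0) + u i * u j := by
  have h : (fun w : Fin d → ℝ => (w i + u i) * (w j + u j)) =
      fun w => w i * w j + (u j * w i + u i * w j) + u i * u j := by ext w; ring
  have h1 : Integrable (fun w : Fin d → ℝ => u j * w i) (gaussianVector d) :=
    (integrable_gaussianVector_eval i).const_mul _
  have h2 : Integrable (fun w : Fin d → ℝ => u i * w j) (gaussianVector d) :=
    (integrable_gaussianVector_eval j).const_mul _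
  have h12 : Integrable (fun w : Fin d → ℝ => u j * w i + u i * w j) (gaussianVector d) :=
    h1.add h2
  have h3 : Integrable (fun w : Fin d → ℝ => w i * w j + (u j * w i + u i * w j))
    (gaussianVector d) := (integrable_gaussianVector_eval_mul i j).add h12
  rw [h, integral_add h3 (integrable_const _),
    integral_add (integrable_gaussianVector_eval_mul i j) h12, integral_add h1 h2,
    integral_const_mul, integral_const_mul, integral_eval_mul_eval_gaussianVector,
    integral_eval_pi (fun _ : Fin d => 1 / (d : NNReal)) i,
    integral_eval_pi (fun _ : Fin d => 1 / (d : NNReal)) j]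
  simp

lemma integrable_shifted_quadratic (M : Matrix (Fin d) (Fin d) ℝ) (u : Fin d → ℝ) :
    Integrable (fun w => frob M (vecMulVec (w + u) (w + u))) (gaussianVector d) :=
  integrable_finsetSum _ fun i _ => integrable_finsetSum _ fun j _ =>
    (integrable_shifted_entry u i j).const_mul _

lemma integral_shifted_quadratic (M : Matrix (Fin d) (Fin d) ℝ) (u : Fin d → ℝ) :
    ∫ w, frob M (vecMulVec (w + u) (w + u)) ∂(gaussianVector d) =
      M.trace / d + u ⬝ᵥ M *ᵥ u := by
  simp only [frob, vecMulVec_apply, Pi.add_apply]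
  have h1 : ∀ i j, Integrable (fun w : Fin d → ℝ => M i j * ((w i + u i) * (w j + u j)))
      (gaussianVector d) := fun i j => (integrable_shifted_entry u i j).const_mul _
  refine (integral_finsetSum Finset.univ
    (f := fun i (w : Fin d → ℝ) => ∑ j, M i j * ((w i + u i) * (w j + u j)))
    fun i _ => integrable_finsetSum _ fun j _ => h1 i j).trans ?_
  have h2 : ∀ i, ∫ w, ∑ j, M i j * ((w i + u i) * (w j + u j)) ∂(gaussianVector d) =
      ∑ j, (M i j * (if i = j then 1 / (d : ℝ) else 0) + M i j * (u i * u j)) := fun i =>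
    (integral_finsetSum Finset.univ
      (f := fun j (w : Fin d → ℝ) => M i j * ((w i + u i) * (w j + u j)))
      fun j _ => h1 i j).trans (Finset.sum_congr rfl fun j _ => by
        rw [integral_const_mul, integral_shifted_entry, mul_add])
  simp_rw [h2, Finset.sum_add_distrib]
  rw [dotProduct_mulVec_eq_frob]
  simp [frob, vecMulVec_apply, Matrix.trace, div_eq_mul_inv, Finset.sum_mul]

lemma memLp_shifted_sq (m : ℝ) (v : NNReal) :
    MemLp (fun x : ℝ => (x + m) ^ 2) 2 (gaussianReal 0 v) := by
  rw [memLp_two_iff_integrable_sq (by fun_prop)]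
  have h : MemLp (fun x : ℝ => x + m) 4 (gaussianReal 0 v) :=
    (memLp_id_gaussianReal' (μ := 0) (v := v) 4 (by simp)).add (memLp_const m)
  refine (h.integrable_norm_pow (by norm_num)).congr (Filter.Eventually.of_forall fun x => ?_)
  simp only [Real.norm_eq_abs]
  rw [← abs_pow, abs_of_nonneg (by positivity)]; ring

lemma integrable_pow_four_gaussianReal (v : NNReal) :
    Integrable (fun x : ℝ => x ^ 4) (gaussianReal 0 v) := by
  have := (memLp_two_iff_integrable_sq (by fun_prop)).1 (memLp_shifted_sq 0 v)
  refine this.congr (Filter.Eventually.of_forall fun x => ?_)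
  simp only [add_zero]; ring

lemma integral_pow_four_gaussianReal_le {v : NNReal} (hv : v ≠ 0) :
    ∫ x, x ^ 4 ∂(gaussianReal 0 v) ≤ 80 * (v : ℝ) ^ 2 := by
  have h := integral_linear_pow_four_pi_le (fun _ : Unit => v) (fun _ => 1) (s := v)
    (by positivity) (by simp)
  have h2 := integral_comp_eval (μ := fun _ : Unit => gaussianReal 0 v) (i := ())
    (f := fun x : ℝ => x ^ 4) (by fun_prop)
  simpa [← h2] using h

lemma integral_sq_gaussianReal (v : NNReal) : ∫ x, x ^ 2 ∂(gaussianReal 0 v) = v := by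
  have h := variance_fun_id_gaussianReal (μ := 0) (v := v)
  rwa [variance_of_integral_eq_zero (by fun_prop) integral_id_gaussianReal] at h

/-- After removing the constant `m²`, `(x² + 2mx)² ≤ 2x⁴ + 8m²x²`. -/
lemma variance_shifted_sq_le (m : ℝ) {v : NNReal} (hv : v ≠ 0) :
    Var[fun x : ℝ => (x + m) ^ 2; gaussianReal 0 v] ≤ 160 * (v : ℝ) ^ 2 + 8 * m ^ 2 * v := by
  rw [← variance_sub_const (c := m ^ 2) (by fun_prop)]
  refine (variance_le_expectation_sq (by fun_prop)).trans ?_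
  have hI4 := integrable_pow_four_gaussianReal v
  have hI2 : Integrable (fun x : ℝ => x ^ 2) (gaussianReal 0 v) :=
    (memLp_id_gaussianReal' (μ := 0) (v := v) 2 (by simp)).integrable_sq
  calc ∫ x, ((fun x : ℝ => (x + m) ^ 2 - m ^ 2) ^ 2) x ∂(gaussianReal 0 v)
      ≤ ∫ x, (2 * x ^ 4 + 8 * m ^ 2 * x ^ 2) ∂(gaussianReal 0 v) := by
        refine integral_mono_of_nonneg (Filter.Eventually.of_forall fun x => by
          simp only [Pi.pow_apply, Pi.zero_apply]; positivity)
          ((hI4.const_mul _).add (hI2.const_mul _)) (Filter.Eventually.of_forall fun x => ?_)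
        simp only [Pi.pow_apply]
        nlinarith [sq_nonneg (x ^ 2 - 2 * m * x)]
    _ = 2 * ∫ x, x ^ 4 ∂(gaussianReal 0 v) + 8 * m ^ 2 * v := by
        rw [integral_add (hI4.const_mul _) (hI2.const_mul _), integral_const_mul,
          integral_const_mul, integral_sq_gaussianReal]
    _ ≤ _ := by linarith [integral_pow_four_gaussianReal_le hv]

lemma memLp_shifted_normSq (u : Fin d → ℝ) :
    MemLp (fun w : Fin d → ℝ => (w + u) ⬝ᵥ (w + u)) 2 (gaussianVector d) := by
  refine memLp_finsetSum _ fun i _ => ?_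
  refine ((memLp_shifted_sq (u i) _).comp_measurePreserving
    (measurePreserving_eval (fun _ : Fin d => gaussianReal 0 (1 / (d : NNReal))) i)).ae_eq
    (Filter.Eventually.of_forall fun w => ?_)
  simp [sq]

/-- The squared norm has mean `1 + ‖u‖² = 2` and variance at most `(160 + 8)/d`. -/
lemma integral_shifted_normSq_sq_le (hd : 0 < d) {u : Fin d → ℝ} (hu : u ⬝ᵥ u = 1) :
    ∫ w, ((w + u) ⬝ᵥ (w + u)) ^ 2 ∂(gaussianVector d) ≤ 4 + 168 / d := by
  have hd' : (d : ℝ) ≠ 0 := by positivity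
  have hdN : (d : NNReal) ≠ 0 := by positivity
  have hmean : ∫ w, (w + u) ⬝ᵥ (w + u) ∂(gaussianVector d) = 2 := by
    have h := integral_shifted_quadratic (1 : Matrix (Fin d) (Fin d) ℝ) u
    simp_rw [← dotProduct_mulVec_eq_frob, one_mulVec] at h
    rw [h, hu]
    simp [hd']; norm_num
  have hvar := variance_eq_sub (memLp_shifted_normSq u)
  have hsum := variance_sum_pi (μ := fun _ : Fin d => gaussianReal 0 (1 / (d : NNReal)))
    (X := fun i x => (x + u i) ^ 2) fun i => memLp_shifted_sq (u i) _
  have he : (∑ i, fun w : Fin d → ℝ => (w i + u i) ^ 2) = fun w => (w + u) ⬝ᵥ (w + u) := by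
    ext w; simp [dotProduct, sq]
  rw [he, hvar, hmean] at hsum
  have hle : ∑ i, Var[fun x : ℝ => (x + u i) ^ 2; gaussianReal 0 (1 / (d : NNReal))] ≤
      168 / d := by
    calc _ ≤ ∑ i, (160 * (1 / (d : ℝ)) ^ 2 + 8 * u i ^ 2 * (1 / (d : ℝ))) := by
          refine Finset.sum_le_sum fun i _ => ?_
          simpa using variance_shifted_sq_le (u i) (v := 1 / (d : NNReal)) (by simp [hdN])
      _ = 160 / d + 8 * (u ⬝ᵥ u) / d := by
          simp only [Finset.sum_add_distrib, Finset.sum_const, Finset.card_univ, Fintype.card_fin,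
            nsmul_eq_mul, dotProduct, Finset.mul_sum, Finset.sum_div]
          congr 1
          · field_simp
          · exact Finset.sum_congr rfl fun i _ => by ring
      _ = _ := by rw [hu]; ring
  have h3 : ∫ w, ((w + u) ⬝ᵥ (w + u)) ^ 2 ∂(gaussianVector d) =
    ∫ w, ((fun w : Fin d → ℝ => (w + u) ⬝ᵥ (w + u)) ^ 2) w ∂(gaussianVector d) := rfl
  rw [h3]
  linarith

end GaussianVector

/-! ### Operator norm tail by Gaussian smoothing instead of a net. -/

section OperatorNormTail

open Matrix

variable {d : ℕ}

lemma continuous_symMat : Continuous (symMat : (Sym2 (Fin d) → ℝ) → Matrix (Fin d) (Fin d) ℝ) :=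
  continuous_matrix fun i j => by simpa [symMat] using continuous_apply s(i, j)

lemma continuous_center : Continuous (center : Matrix (Fin d) (Fin d) ℝ → _) := by
  unfold center
  exact continuous_id.sub ((continuous_id.matrix_trace.div_const _).smul continuous_const)

lemma continuous_goeMat : Continuous (goeMat : (Sym2 (Fin d) → ℝ) → Matrix (Fin d) (Fin d) ℝ) :=
  continuous_center.comp continuous_symMat

lemma continuous_frob : Continuous fun p : Matrix (Fin d) (Fin d) ℝ × Matrix (Fin d) (Fin d) ℝ =>
    frob p.1 p.2 := by
  unfold frob
  exact continuous_finsetSum _ fun i _ => continuous_finsetSum _ fun j _ =>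
    (continuous_fst.matrix_elem i j).mul (continuous_snd.matrix_elem i j)

/-- The exponential functional of a quadratic form at a random point, with a penalty that makes its
mean over the GOE at most one. -/
noncomputable def quadraticMgf (s : ℝ) (g : Sym2 (Fin d) → ℝ) : ENNReal :=
  ∫⁻ w, ENNReal.ofReal (Real.exp (s * frob (goeMat g) (vecMulVec w w) - s ^ 2 / d * (w ⬝ᵥ w) ^ 2))
    ∂(gaussianVector d)

lemma continuous_quadraticMgf_integrand (s : ℝ) :
    Continuous fun p : (Sym2 (Fin d) → ℝ) × (Fin d → ℝ) =>
      Real.exp (s * frob (goeMat p.1) (vecMulVec p.2 p.2) - s ^ 2 / d * (p.2 ⬝ᵥ p.2) ^ 2) := by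
  have h1 : Continuous fun p : (Sym2 (Fin d) → ℝ) × (Fin d → ℝ) =>
      frob (goeMat p.1) (vecMulVec p.2 p.2) :=
    continuous_frob.comp ((continuous_goeMat.comp continuous_fst).prodMk
      (continuous_snd.matrix_vecMulVec continuous_snd))
  have h2 : Continuous fun p : (Sym2 (Fin d) → ℝ) × (Fin d → ℝ) => p.2 ⬝ᵥ p.2 :=
    continuous_snd.dotProduct continuous_snd
  fun_prop

lemma isSymm_vecMulVec_self (w : Fin d → ℝ) : (vecMulVec w w).IsSymm :=
  Matrix.IsSymm.ext fun i j => by simp [vecMulVec_apply, mul_comm]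

/-- For fixed `w` the quadratic form is a centered Gaussian of variance at most `(2/d)‖w‖⁴`, and the
penalty is the matching bound for its log-moment generating function. -/
lemma lintegral_quadraticMgf_le_one (s : ℝ) :
    ∫⁻ g, quadraticMgf s g ∂(goeEntries d) ≤ 1 := by
  unfold quadraticMgf
  rw [lintegral_lintegral_swap
    (continuous_quadraticMgf_integrand s).measurable.ennreal_ofReal.aemeasurable]
  calc _ ≤ ∫⁻ _ : Fin d → ℝ, 1 ∂(gaussianVector d) := lintegral_mono fun w => ?_
    _ = 1 := by simp
  set X := vecMulVec w w with hX
  have hs : X.IsSymm := isSymm_vecMulVec_self w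
  have he : ∀ g : Sym2 (Fin d) → ℝ, Real.exp (s * frob (goeMat g) X - s ^ 2 / d * (w ⬝ᵥ w) ^ 2) =
      Real.exp (-(s ^ 2 / d * (w ⬝ᵥ w) ^ 2)) * Real.exp (∑ p, (s * goeCoeff X p) * g p) := by
    intro g
    rw [frob_goeMat hs, ← Real.exp_add, Finset.mul_sum, sub_eq_neg_add]
    simp only [mul_assoc]
  simp_rw [he]
  rw [← ofReal_integral_eq_lintegral_ofReal
    ((integrable_exp_linear_pi _ _).const_mul _)
    (Filter.Eventually.of_forall fun g => by positivity), integral_const_mul,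
    integral_exp_linear_pi, ← Real.exp_add, ENNReal.ofReal_le_one, Real.exp_le_one_iff]
  have h1 : ∑ p, (s * goeCoeff X p) ^ 2 * (goeVar d p : ℝ) =
      s ^ 2 * (2 / d * frob (center X) (center X)) := by
    rw [← sum_goeCoeff_sq hs, Finset.mul_sum]
    exact Finset.sum_congr rfl fun p _ => by ring
  rw [h1]
  have h2 := frob_center_self_le X
  rw [hX, frob_vecMulVec_self, ← hX] at h2
  have h3 : 0 ≤ s ^ 2 / d := by positivity
  have h4 : s ^ 2 * (2 / d * frob (center X) (center X)) / 2 =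
    s ^ 2 / d * frob (center X) (center X) := by ring
  rw [h4]
  nlinarith

/-- Recentering the Gaussian vector at `u` costs `d/2` in the exponent after Jensen's inequality.
The quadratic form then averages to its value at `u`, as `goeMat g` has trace zero. A single bad
direction thus makes the whole average large. -/
lemma le_quadraticMgf (hd : 0 < d) (s : ℝ) (g : Sym2 (Fin d) → ℝ) {u : Fin d → ℝ}
    (hu : u ⬝ᵥ u = 1) :
    ENNReal.ofReal (Real.exp (s * (u ⬝ᵥ goeMat g *ᵥ u) - s ^ 2 / d * (4 + 168 / d) - d / 2)) ≤
      quadraticMgf s g := by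
  have hdN : (1 / (d : NNReal)) ≠ 0 := by positivity
  have hd' : (d : ℝ) ≠ 0 := by positivity
  have hmeas : Measurable fun w : Fin d → ℝ => ENNReal.ofReal (Real.exp
      (s * frob (goeMat g) (vecMulVec w w) - s ^ 2 / d * (w ⬝ᵥ w) ^ 2)) :=
    ((continuous_quadraticMgf_integrand s).comp (Continuous.prodMk_right g)).measurable.ennreal_ofReal
  rw [quadraticMgf, lintegral_pi_gaussian_shift (fun _ : Fin d => 1 / (d : NNReal)) (fun _ => hdN) u _
    hmeas]
  simp_rw [← ENNReal.ofReal_mul (Real.exp_pos _).le, ← Real.exp_add]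
  have hI0 : Integrable (fun w : Fin d → ℝ =>
      ∑ i, (-(u i * w i / ((1 / (d : NNReal) : NNReal) : ℝ)) -
        u i ^ 2 / (2 * ((1 / (d : NNReal) : NNReal) : ℝ)))) (gaussianVector d) :=
    integrable_finsetSum _ fun i _ =>
      ((((integrable_gaussianVector_eval i).const_mul _).div_const _).neg).sub (integrable_const _)
  have hI1 : Integrable (fun w => s * frob (goeMat g) (vecMulVec (w + u) (w + u)))
    (gaussianVector d) := (integrable_shifted_quadratic (goeMat g) u).const_mul s
  have hI2 : Integrable (fun w => s ^ 2 / d * ((w + u) ⬝ᵥ (w + u)) ^ 2) (gaussianVector d) :=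
    (memLp_shifted_normSq u).integrable_sq.const_mul _
  have hI12 : Integrable (fun w => s * frob (goeMat g) (vecMulVec (w + u) (w + u)) -
    s ^ 2 / d * ((w + u) ⬝ᵥ (w + u)) ^ 2) (gaussianVector d) := hI1.sub hI2
  refine le_trans (ENNReal.ofReal_le_ofReal (Real.exp_le_exp.2 ?_))
    (ofReal_exp_integral_le_lintegral (gaussianVector d) _ (hI0.add hI12))
  have hE0 : ∫ w, ∑ i, (-(u i * w i / ((1 / (d : NNReal) : NNReal) : ℝ)) -
        u i ^ 2 / (2 * ((1 / (d : NNReal) : NNReal) : ℝ))) ∂(gaussianVector d) =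
        -((d : ℝ) / 2) := by
    have h : ∀ w : Fin d → ℝ, ∑ i, (-(u i * w i / ((1 / (d : NNReal) : NNReal) : ℝ)) -
        u i ^ 2 / (2 * ((1 / (d : NNReal) : NNReal) : ℝ))) =
        ∑ i, (-(d * u i)) * w i - d / 2 := by
      intro w
      have : (d : ℝ) / 2 = ∑ i, d / 2 * (u i * u i) := by
        rw [← Finset.mul_sum]; simp only [dotProduct] at hu; rw [hu, mul_one]
      rw [this, ← Finset.sum_sub_distrib]
      refine Finset.sum_congr rfl fun i _ => ?_
      simp only [NNReal.coe_div, NNReal.coe_one, NNReal.coe_natCast]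
      field_simp
    simp_rw [h]
    rw [integral_sub ((memLp_linear_pi _ _ 1 (by simp)).integrable le_rfl) (integrable_const _),
      integral_linear_pi]
    simp
  rw [integral_add hI0 hI12, integral_sub hI1 hI2, hE0, integral_const_mul, integral_const_mul,
    integral_shifted_quadratic, trace_goeMat]
  have h1 := integral_shifted_normSq_sq_le hd hu
  have h2 : 0 ≤ s ^ 2 / d := by positivity
  have h3 := mul_le_mul_of_nonneg_left h1 h2
  simp only [zero_div, zero_add]
  linarith

/-- Upper tail bound for a quadratic form of a trace-centered GOE matrix (`σ = 1`) or of its negative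
(`σ = -1`). -/
lemma measure_exists_quadratic_ge_le (hd : 0 < d) {σ : ℝ} (hσ : σ ^ 2 = 1) :
    goeEntries d {g | ∃ u : Fin d → ℝ, u ⬝ᵥ u = 1 ∧ 29 / 10 ≤ σ * (u ⬝ᵥ goeMat g *ᵥ u)} ≤
      ENNReal.ofReal (Real.exp (23 - d / 40)) := by
  have hd' : (d : ℝ) ≠ 0 := by positivity
  have hd1 : (1 : ℝ) ≤ d := by exact_mod_cast hd
  -- For `σ = 1` this `s` maximizes `(29/10) s - 4 s²/d`. The maximum `(29/10)² d/16` exceeds the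
  -- cost `d/2` by more than `d/40`; the `168/d` correction costs at most `23`.
  set s : ℝ := σ * (29 / 80 * d) with hs
  have hs2 : s ^ 2 = (29 / 80 * d) ^ 2 := by rw [hs, mul_pow, hσ, one_mul]
  set K : ℝ := d / 40 - 23 with hK
  have hsub : {g : Sym2 (Fin d) → ℝ | ∃ u : Fin d → ℝ, u ⬝ᵥ u = 1 ∧
      29 / 10 ≤ σ * (u ⬝ᵥ goeMat g *ᵥ u)} ⊆
      {g | ENNReal.ofReal (Real.exp K) ≤ quadraticMgf s g} := by
    rintro g ⟨u, hu, hug⟩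
    refine le_trans (ENNReal.ofReal_le_ofReal (Real.exp_le_exp.2 ?_)) (le_quadraticMgf hd s g hu)
    have h1 : s * (u ⬝ᵥ goeMat g *ᵥ u) = 29 / 80 * d * (σ * (u ⬝ᵥ goeMat g *ᵥ u)) := by
      rw [hs]; ring
    have h2 : s ^ 2 / d * (4 + 168 / d) = (29 / 80) ^ 2 * (4 * d + 168) := by
      rw [hs2]; field_simp
    rw [h1, h2, hK]
    have h3 : 29 / 80 * (d : ℝ) * (29 / 10) ≤ 29 / 80 * d * (σ * (u ⬝ᵥ goeMat g *ᵥ u)) := by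
      gcongr
    nlinarith
  have hmeas : Measurable (quadraticMgf (d := d) s) :=
    (continuous_quadraticMgf_integrand s).measurable.ennreal_ofReal.lintegral_prod_right
  have hKpos : ENNReal.ofReal (Real.exp K) ≠ 0 := by
    simpa using Real.exp_pos K
  -- Markov's inequality for one measurable event that contains the union over all directions `u`.
  calc _ ≤ goeEntries d {g | ENNReal.ofReal (Real.exp K) ≤ quadraticMgf s g} := measure_mono hsub
    _ ≤ (∫⁻ g, quadraticMgf s g ∂(goeEntries d)) / ENNReal.ofReal (Real.exp K) :=
        meas_ge_le_lintegral_div hmeas.aemeasurable hKpos ENNReal.ofReal_ne_top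
    _ ≤ 1 / ENNReal.ofReal (Real.exp K) := by
        gcongr; exact lintegral_quadraticMgf_le_one s
    _ = _ := by
        rw [one_div, ← ENNReal.ofReal_inv_of_pos (Real.exp_pos K), ← Real.exp_neg, hK]
        congr 2; ring

end OperatorNormTail

/-! ### Lower tail of the Frobenius norm. -/

section FrobeniusTail

variable {d : ℕ}

/-- The square of an off-diagonal entry. -/
def offDiagSq (p : Sym2 (Fin d)) (x : ℝ) : ℝ := if p.IsDiag then 0 else x ^ 2

lemma memLp_offDiagSq (p : Sym2 (Fin d)) (v : NNReal) :
    MemLp (offDiagSq p) 2 (gaussianReal 0 v) := by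
  unfold offDiagSq
  split_ifs
  · exact MemLp.zero'
  · simpa using memLp_shifted_sq 0 v

/-- Centering alters only the diagonal, so the off-diagonal entries stay independent, and they carry
enough of the norm. -/
lemma sum_offDiagSq_le_frob (g : Sym2 (Fin d) → ℝ) :
    ∑ p, symMult p * offDiagSq p (g p) ≤ frob (goeMat g) (goeMat g) := by
  rw [← sum_sum_sym2 fun p => offDiagSq p (g p)]
  refine Finset.sum_le_sum fun i _ => Finset.sum_le_sum fun j _ => ?_
  by_cases h : i = j
  · simp [offDiagSq, h, mul_self_nonneg]
  · simp [offDiagSq, h, goeMat, center, symMat, sq]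

/-- Chebyshev's inequality for the off-diagonal part, with mean `d - 1` and variance at most `160`.
For `d ≥ 4` the mean exceeds `d/2` by at least `d/4`. -/
lemma measure_frob_lt_le (hd : 4 ≤ d) :
    goeEntries d {g | frob (goeMat g) (goeMat g) < d / 2} ≤ ENNReal.ofReal (2560 / d) := by
  have hd0 : 0 < d := by omega
  have hd' : (d : ℝ) ≠ 0 := by positivity
  have hd4 : (4 : ℝ) ≤ d := by exact_mod_cast hd
  set X : (Sym2 (Fin d) → ℝ) → ℝ := fun g => ∑ p, symMult p * offDiagSq p (g p) with hX
  have hmem : ∀ p : Sym2 (Fin d), MemLp (fun x => symMult p * offDiagSq p x) 2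
      (gaussianReal 0 (goeVar d p)) := fun p => (memLp_offDiagSq p _).const_mul _
  have hmem' : ∀ p : Sym2 (Fin d), MemLp (fun g : Sym2 (Fin d) → ℝ => symMult p * offDiagSq p (g p)) 2
      (goeEntries d) := fun p => (hmem p).comp_measurePreserving
        (measurePreserving_eval (fun p => gaussianReal 0 (goeVar d p)) p)
  have hcount : ∑ p : Sym2 (Fin d), symMult p * (if p.IsDiag then (0 : ℝ) else 1) =
      d * (d - 1) := by
    rw [← sum_sum_sym2]
    have : ∀ i j : Fin d, (if s(i, j).IsDiag then (0 : ℝ) else 1) = 1 - if i = j then 1 else 0 := by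
      intro i j
      by_cases h : i = j <;> simp [h]
    simp_rw [this]
    simp only [Finset.sum_sub_distrib, Finset.sum_const, Finset.card_univ, Fintype.card_fin,
      nsmul_eq_mul, mul_one, Finset.sum_ite_eq, Finset.mem_univ, if_true]
    ring
  have hmean : ∫ g, X g ∂(goeEntries d) = d - 1 := by
    rw [hX, integral_finsetSum _ fun p _ => (hmem' p).integrable (by norm_num)]
    have : ∀ p : Sym2 (Fin d), ∫ g, symMult p * offDiagSq p (g p) ∂(goeEntries d) =
        (1 / d) * (symMult p * (if p.IsDiag then (0 : ℝ) else 1)) := by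
      intro p
      have h := integral_comp_eval (μ := fun p => gaussianReal 0 (goeVar d p)) (i := p)
        (f := fun x => symMult p * offDiagSq p x) (hmem p).aestronglyMeasurable
      rw [h, integral_const_mul]
      unfold offDiagSq
      split_ifs with hp
      · simp
      · rw [integral_sq_gaussianReal]; simp [goeVar, hp]; ring
    simp_rw [this]
    rw [← Finset.mul_sum, hcount]
    field_simp
  have hvar : Var[X; goeEntries d] ≤ 160 := by
    have h := variance_sum_pi hmem
    have he : (∑ p, fun g : Sym2 (Fin d) → ℝ => symMult p * offDiagSq p (g p)) = X := by
      ext g; simp [hX]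
    rw [he] at h
    rw [h]
    calc _ ≤ ∑ p : Sym2 (Fin d), 160 / (d : ℝ) ^ 2 * (symMult p * (if p.IsDiag then (0 : ℝ) else 1)) := by
          refine Finset.sum_le_sum fun p _ => ?_
          rw [variance_const_mul]
          unfold offDiagSq
          split_ifs with hp
          · have : Var[fun _ : ℝ => (0 : ℝ); gaussianReal 0 (goeVar d p)] = 0 := variance_zero _
            simp [this]
          · have hv : goeVar d p = 1 / d := by simp [goeVar, hp]
            have h2 : symMult p = 2 := by simp [symMult, hp]
            have h1 := variance_le_expectation_sq (X := fun x : ℝ => x ^ 2)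
              (μ := gaussianReal 0 (goeVar d p)) (by fun_prop)
            have h3 := integral_pow_four_gaussianReal_le (goeVar_ne_zero hd0 p)
            have h4 : ∫ x, ((fun x : ℝ => x ^ 2) ^ 2) x ∂(gaussianReal 0 (goeVar d p)) =
              ∫ x, x ^ 4 ∂(gaussianReal 0 (goeVar d p)) := by
              congr 1; ext x; simp only [Pi.pow_apply]; ring
            rw [h4] at h1
            have h5 : 80 * (goeVar d p : ℝ) ^ 2 = 80 / d ^ 2 := by
              rw [hv]; simp; ring
            rw [h5] at h3
            rw [h2]
            have h6 : 160 / (d : ℝ) ^ 2 * (2 * 1) = 4 * (80 / d ^ 2) := by ring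
            rw [h6]; linarith
      _ = 160 * (d * (d - 1) / (d : ℝ) ^ 2) := by rw [← Finset.mul_sum, hcount]; ring
      _ ≤ 160 * 1 := by
          gcongr
          rw [div_le_one (by positivity)]; nlinarith
      _ = 160 := by ring
  have hXmem : MemLp X 2 (goeEntries d) := memLp_finsetSum _ fun p _ => hmem' p
  have hc : (0 : ℝ) < d / 4 := by positivity
  refine (measure_mono ?_).trans ((meas_ge_le_variance_div_sq hXmem hc).trans
    (ENNReal.ofReal_le_ofReal ?_))
  · intro g hg
    have h1 := sum_offDiagSq_le_frob g
    simp only [Set.mem_ofPred_eq] at hg ⊢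
    rw [hmean]
    have h2 : X g < d / 2 := lt_of_le_of_lt h1 hg
    rw [abs_sub_comm]
    exact le_trans (by linarith) (le_abs_self _)
  · calc Var[X; goeEntries d] / ((d : ℝ) / 4) ^ 2 ≤ 160 / ((d : ℝ) / 4) ^ 2 := by gcongr
      _ = 2560 / ((d : ℝ) * d) := by field_simp; norm_num
      _ ≤ 2560 / (d : ℝ) := by
        gcongr; nlinarith

end FrobeniusTail

/-! ### The typical set and its probability. -/

section TypicalSet

open Matrix

/-- A symmetric event of high probability that stays in the truncation event under small shifts. -/
def typicalSet (d : ℕ) : Set (Sym2 (Fin d) → ℝ) :=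
  {g | (∀ x : Fin d → ℝ, |x ⬝ᵥ goeMat g *ᵥ x| ≤ 29 / 10 * (x ⬝ᵥ x)) ∧
    (d : ℝ) / 2 ≤ frob (goeMat g) (goeMat g)}

lemma measurableSet_typicalSet (d : ℕ) : MeasurableSet (typicalSet d) := by
  refine IsClosed.measurableSet ?_
  have h1 : ∀ x : Fin d → ℝ, Continuous fun g => x ⬝ᵥ goeMat g *ᵥ x := fun x =>
    continuous_const.dotProduct (continuous_goeMat.matrix_mulVec continuous_const)
  have h2 : Continuous fun g : Sym2 (Fin d) → ℝ => frob (goeMat g) (goeMat g) :=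
    continuous_frob.comp (continuous_goeMat.prodMk continuous_goeMat)
  rw [typicalSet, Set.ofPred_and, Set.ofPred_forall]
  exact (isClosed_iInter fun x => isClosed_le (h1 x).abs continuous_const).inter
    (isClosed_le continuous_const h2)

/-- The constant in the probability bound for the complement of `typicalSet`. -/
noncomputable def typicalConst : ℝ := 2560 + 80 * Real.exp 23

lemma typicalConst_pos : 0 < typicalConst := by unfold typicalConst; positivity

lemma measure_typicalSet_compl_le {d : ℕ} (hd : 4 ≤ d) :
    (goeEntries d).real (typicalSet d)ᶜ ≤ typicalConst / d := by
  have hd0 : 0 < d := by omega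
  have hd' : (0 : ℝ) < d := by positivity
  set E : ℝ → Set (Sym2 (Fin d) → ℝ) := fun σ =>
    {g | ∃ u : Fin d → ℝ, u ⬝ᵥ u = 1 ∧ 29 / 10 ≤ σ * (u ⬝ᵥ goeMat g *ᵥ u)} with hE
  have hsub : (typicalSet d)ᶜ ⊆ (E 1 ∪ E (-1)) ∪ {g | frob (goeMat g) (goeMat g) < d / 2} := by
    intro g hg
    by_contra hcon
    simp only [Set.mem_union, not_or, Set.mem_ofPred_eq, not_lt] at hcon
    obtain ⟨⟨h1, h2⟩, h3⟩ := hcon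
    refine hg ⟨fun x => ?_, h3⟩
    by_contra! hx
    have hx0 : 0 < x ⬝ᵥ x := by
      rcases (dotProduct_self_nonneg' x).lt_or_eq with h | h
      · exact h
      · rw [dotProduct_self_eq_zero.1 h.symm] at hx
        simp at hx
    set r := Real.sqrt (x ⬝ᵥ x) with hr
    have hr0 : 0 < r := Real.sqrt_pos.2 hx0
    have hr2 : r ^ 2 = x ⬝ᵥ x := Real.sq_sqrt hx0.le
    have hu : (r⁻¹ • x) ⬝ᵥ (r⁻¹ • x) = 1 := by
      rw [smul_dotProduct, dotProduct_smul, ← hr2]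
      simp only [smul_eq_mul]; field_simp
    have hq : (r⁻¹ • x) ⬝ᵥ goeMat g *ᵥ (r⁻¹ • x) = (x ⬝ᵥ goeMat g *ᵥ x) / r ^ 2 := by
      rw [mulVec_smul, smul_dotProduct, dotProduct_smul]
      simp only [smul_eq_mul]; field_simp
    rw [← hr2] at hx
    rcases le_abs'.1 hx.le with h | h
    · exact h2 ⟨r⁻¹ • x, hu, by
        rw [hq, ← mul_div_assoc, le_div_iff₀ (by positivity)]; linarith⟩
    · exact h1 ⟨r⁻¹ • x, hu, by
        rw [hq, ← mul_div_assoc, le_div_iff₀ (by positivity)]; linarith⟩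
  -- The exponential tail is weakened to order `1/d`, like the Chebyshev bound it is added to.
  have hexp : Real.exp (23 - d / 40) ≤ 40 * Real.exp 23 / d := by
    rw [Real.exp_sub, div_le_div_iff₀ (Real.exp_pos _) hd']
    have := Real.add_one_le_exp ((d : ℝ) / 40)
    nlinarith [Real.exp_pos 23]
  refine ENNReal.toReal_le_of_le_ofReal (by have := typicalConst_pos; positivity) ?_
  calc goeEntries d (typicalSet d)ᶜ
      ≤ (goeEntries d (E 1) + goeEntries d (E (-1))) +
          goeEntries d {g | frob (goeMat g) (goeMat g) < d / 2} :=
        (measure_mono hsub).trans ((measure_union_le _ _).trans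
          (add_le_add_left (measure_union_le _ _) _))
    _ ≤ (ENNReal.ofReal (Real.exp (23 - d / 40)) + ENNReal.ofReal (Real.exp (23 - d / 40))) +
          ENNReal.ofReal (2560 / d) :=
        add_le_add (add_le_add (measure_exists_quadratic_ge_le hd0 (by norm_num))
          (measure_exists_quadratic_ge_le hd0 (by norm_num))) (measure_frob_lt_le hd)
    _ ≤ ENNReal.ofReal (typicalConst / d) := by
        rw [← ENNReal.ofReal_add (Real.exp_pos _).le (Real.exp_pos _).le,
          ← ENNReal.ofReal_add (by positivity) (by positivity)]
        refine ENNReal.ofReal_le_ofReal ?_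
        have : typicalConst / d = 2560 / d + 2 * (40 * Real.exp 23 / d) := by
          unfold typicalConst; ring
        rw [this]; linarith

lemma neg_mem_typicalSet {d : ℕ} (g : Sym2 (Fin d) → ℝ) :
    -g ∈ typicalSet d ↔ g ∈ typicalSet d := by
  simp [typicalSet, goeMat_neg, neg_mulVec, frob]

end TypicalSet

/-! ### Odd functions integrate to zero over the typical set. -/

section Symmetry

lemma measurePreserving_neg_goeEntries (d : ℕ) :
    MeasurePreserving (fun g : Sym2 (Fin d) → ℝ => -g) (goeEntries d) (goeEntries d) := by
  refine ⟨by fun_prop, ?_⟩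
  have := Measure.pi_map_pi (μ := fun p : Sym2 (Fin d) => gaussianReal 0 (goeVar d p))
    (f := fun _ x => -x) (hμ := fun p => by rw [gaussianReal_map_neg]; infer_instance)
    (fun _ => by fun_prop)
  simp_rw [gaussianReal_map_neg, neg_zero] at this
  exact this

lemma setIntegral_typicalSet_of_odd {d : ℕ} {f : (Sym2 (Fin d) → ℝ) → ℝ}
    (hf : ∀ g, f (-g) = -f g) : ∫ g in typicalSet d, f g ∂(goeEntries d) = 0 := by
  have h := (measurePreserving_neg_goeEntries d).setIntegral_preimage_emb
    (MeasurableEquiv.neg (Sym2 (Fin d) → ℝ)).measurableEmbedding f (typicalSet d)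
  have hV : (fun g : Sym2 (Fin d) → ℝ => -g) ⁻¹' typicalSet d = typicalSet d := by
    ext g; exact neg_mem_typicalSet g
  rw [hV] at h
  simp_rw [hf, integral_neg] at h
  linarith

end Symmetry

/-! ### Pathwise lower bound for the averaged likelihood ratio. -/

section LikelihoodRatio

open Matrix

lemma sub_sq_sub_abs_cube_le_log {u : ℝ} (hu : |u| ≤ 1 / 2) :
    u - u ^ 2 / 2 - 2 * |u| ^ 3 ≤ Real.log (1 + u) := by
  have h1 : |(-u)| < 1 := by rw [abs_neg]; linarith
  have h := Real.abs_log_sub_add_sum_range_le h1 2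
  rw [abs_neg, sub_neg_eq_add] at h
  norm_num [Finset.sum_range_succ] at h
  have h2 : |u| ^ 3 / (1 - |u|) ≤ 2 * |u| ^ 3 := by
    rw [div_le_iff₀ (by linarith)]
    nlinarith [pow_nonneg (abs_nonneg u) 3]
  linarith [(abs_le.1 h).1]

/-- The entries of the trace-centered GOE matrices that satisfy the truncation condition. -/
def truncatedEntries (d : ℕ) : Set (Sym2 (Fin d) → ℝ) :=
  {g | (∀ x : Fin d → ℝ, |x ⬝ᵥ goeMat g *ᵥ x| ≤ 3 * (x ⬝ᵥ x)) ∧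
    (d : ℝ) / 4 ≤ frob (goeMat g) (goeMat g)}

lemma goeMat_mem_truncationSet_iff {d : ℕ} (g : Sym2 (Fin d) → ℝ) :
    goeMat g ∈ truncationSet d ↔ g ∈ truncatedEntries d := by
  simp only [truncationSet, truncatedEntries, Set.mem_ofPred_eq,
    norm_toEuclideanCLM_le_iff (goeMat_isSymm g) (by norm_num : (0 : ℝ) ≤ 3), frob, sq]

lemma measurableSet_truncatedEntries (d : ℕ) : MeasurableSet (truncatedEntries d) := by
  refine IsClosed.measurableSet ?_
  have h1 : ∀ x : Fin d → ℝ, Continuous fun g => x ⬝ᵥ goeMat g *ᵥ x := fun x =>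
    continuous_const.dotProduct (continuous_goeMat.matrix_mulVec continuous_const)
  have h2 : Continuous fun g : Sym2 (Fin d) → ℝ => frob (goeMat g) (goeMat g) :=
    continuous_frob.comp (continuous_goeMat.prodMk continuous_goeMat)
  rw [truncatedEntries, Set.ofPred_and, Set.ofPred_forall]
  exact (isClosed_iInter fun x => isClosed_le (h1 x).abs continuous_const).inter
    (isClosed_le continuous_const h2)

lemma typicalSet_subset_truncatedEntries (d : ℕ) : typicalSet d ⊆ truncatedEntries d := by
  rintro g ⟨h1, h2⟩
  refine ⟨fun x => (h1 x).trans ?_, le_trans ?_ h2⟩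
  · nlinarith [dotProduct_self_nonneg' x]
  · linarith [(Nat.cast_nonneg d : (0 : ℝ) ≤ d)]

variable {d n : ℕ}

/-- For the operator norm, `29/10 + 1/10 = 3`. For the Frobenius norm, `‖M + 4H‖² ≥ 0` yields `‖M +
H‖² ≥ (3/4)‖M‖² - 3‖H‖² ≥ 3d/8 - 3/100`. -/
lemma add_entry_mem_truncatedEntries (hd : 0 < d) {g : Sym2 (Fin d) → ℝ} (hg : g ∈ typicalSet d)
    {H : Matrix (Fin d) (Fin d) ℝ} (hH : H.IsSymm) (htr : H.trace = 0)
    (hn : frob H H ≤ 1 / 100) : g + entry H ∈ truncatedEntries d := by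
  have hd1 : (1 : ℝ) ≤ d := by exact_mod_cast hd
  obtain ⟨h1, h2⟩ := hg
  refine ⟨fun x => ?_, ?_⟩
  · have h3 := abs_dotProduct_mulVec_le_of_frob (r := 1 / 10) (by norm_num)
      (by linarith : frob H H ≤ (1 / 10) ^ 2) x
    rw [goeMat_add_entry hH htr, add_mulVec, dotProduct_add]
    exact (abs_add_le _ _).trans (by linarith [h1 x])
  · rw [goeMat_add_entry hH htr]
    set M := goeMat g
    have h3 : 0 ≤ frob (M + (4 : ℝ) • H) (M + (4 : ℝ) • H) := frob_self_nonneg _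
    simp only [frob_add_left, frob_add_right, frob_smul_left, frob_smul_right,
      frob_comm H M] at h3 ⊢
    linarith

/-- Here `a` is the random part of a step and `h` the contribution of the translation. In `log(1 +
u) ≥ u - u²/2 - 2|u|³`, half of the term `ε²h²` is the quadratic part in `h` and the other half
absorbs the cubic part. -/
lemma exp_expansion_le_one_add {ε a h r : ℝ} (hε : 0 ≤ ε) (hε' : ε ≤ 1 / 12) (hr : 0 < r)
    (hu : |ε * (a + h)| ≤ 1 / 2) (hh : h ^ 2 ≤ 1 / 25) :
    Real.exp ((ε * h - ε ^ 2 * h ^ 2) + (ε - ε ^ 2 * h) * a -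
      ((ε ^ 2 / 2 + 4 * ε ^ 3 * r⁻¹) * a ^ 2 + 4 * ε ^ 3 * r * a ^ 4)) ≤ 1 + ε * (a + h) := by
  have hpos : 0 < 1 + ε * (a + h) := by linarith [(abs_le.1 hu).1]
  rw [← Real.le_log_iff_exp_le hpos]
  refine le_trans ?_ (sub_sq_sub_abs_cube_le_log hu)
  have hε3 : 0 ≤ ε ^ 3 := by positivity
  have h1 : |ε * (a + h)| ^ 3 ≤ ε ^ 3 * (4 * (|a| ^ 3 + |h| ^ 3)) := by
    rw [abs_mul, mul_pow, abs_of_nonneg hε]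
    refine mul_le_mul_of_nonneg_left ?_ hε3
    calc |a + h| ^ 3 ≤ (|a| + |h|) ^ 3 := by gcongr; exact abs_add_le a h
      _ ≤ 2 ^ (3 - 1) * (|a| ^ 3 + |h| ^ 3) := add_pow_le (abs_nonneg a) (abs_nonneg h) 3
      _ = _ := by norm_num
  -- AM–GM leaves only even powers of `a`. With `a` of order `d^{-1/2}`, both terms are of order
  -- `d^{-3/2}` when `r = √d`.
  have h2 : |a| ^ 3 ≤ (r⁻¹ * a ^ 2 + r * a ^ 4) / 2 := by
    have h4 : r⁻¹ * a ^ 2 + r * a ^ 4 - 2 * |a| ^ 3 = r⁻¹ * (|a| - r * |a| ^ 2) ^ 2 := by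
      have e2 : a ^ 2 = |a| ^ 2 := (sq_abs a).symm
      have e4 : a ^ 4 = |a| ^ 4 := by rw [show (4 : ℕ) = 2 * 2 from rfl, pow_mul, pow_mul, e2]
      rw [e2, e4]; field_simp; ring
    have : 0 ≤ r⁻¹ * (|a| - r * |a| ^ 2) ^ 2 := by positivity
    linarith
  have h3 : ε ^ 3 * (8 * |h| ^ 3) ≤ ε ^ 2 * h ^ 2 / 2 := by
    have hh' : |h| ≤ 1 / 5 := abs_le_of_sq_le_sq (by linarith) (by norm_num)
    have e : ε ^ 3 * (8 * |h| ^ 3) = (ε ^ 2 * h ^ 2) * (8 * (ε * |h|)) := by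
      rw [← sq_abs h]; ring
    have hp : 0 ≤ ε ^ 2 * h ^ 2 := by positivity
    have : ε * |h| ≤ 1 / 12 * (1 / 5) := mul_le_mul hε' hh' (abs_nonneg h) (by norm_num)
    rw [e]
    nlinarith
  have h5 := mul_le_mul_of_nonneg_left h2 hε3
  nlinarith

lemma integrable_cond_typicalSet {f : (Sym2 (Fin d) → ℝ) → ℝ} (hf : Integrable f (goeEntries d))
    (hV : goeEntries d (typicalSet d) ≠ 0) :
    Integrable f (cond (goeEntries d) (typicalSet d)) :=
  hf.restrict.smul_measure (ENNReal.inv_ne_top.2 hV)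

lemma integral_cond_typicalSet (f : (Sym2 (Fin d) → ℝ) → ℝ) :
    ∫ g, f g ∂(cond (goeEntries d) (typicalSet d)) =
      ((goeEntries d).real (typicalSet d))⁻¹ * ∫ g in typicalSet d, f g ∂(goeEntries d) := by
  rw [ProbabilityTheory.cond, integral_smul_measure, ENNReal.toReal_inv]; rfl

/-- For nonnegative functions, conditioning costs at most the inverse probability of the typical
set. -/
lemma integral_cond_typicalSet_le {f : (Sym2 (Fin d) → ℝ) → ℝ} (hf : Integrable f (goeEntries d))
    (h0 : ∀ g, 0 ≤ f g) {b : ℝ} (hb : ∫ g, f g ∂(goeEntries d) ≤ b) :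
    ∫ g, f g ∂(cond (goeEntries d) (typicalSet d)) ≤
      ((goeEntries d).real (typicalSet d))⁻¹ * b := by
  rw [integral_cond_typicalSet]
  exact mul_le_mul_of_nonneg_left ((setIntegral_le_integral hf
    (Filter.Eventually.of_forall h0)).trans hb) (by positivity)

lemma frob_center_center_le_four {y : Matrix (Fin d) (Fin d) ℝ} (hy : y.PosSemidef)
    (htr : y.trace ≤ 2) : frob (center y) (center y) ≤ 4 := by
  have h1 := frob_center_self_le y
  have h2 := hy.frob_self_le_trace_sq
  have h3 : 0 ≤ y.trace := hy.trace_nonneg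
  nlinarith

/-- Lower bound for the averaged likelihood ratio along a path. -/
lemma le_lintegral_likelihood (hd : 0 < d) {ε : ℝ} (hε : 0 ≤ ε) (hε' : ε ≤ 1 / 12)
    (y : Fin n → Matrix (Fin d) (Fin d) ℝ) (hy : ∀ t, (y t).PosSemidef)
    (htr : ∀ t, (y t).trace ≤ 2) {S : Matrix (Fin d) (Fin d) ℝ} (hS : S = ∑ t, center (y t))
    {v : ℝ} (hv : v = (goeEntries d).real (typicalSet d)) (hv0 : 0 < v)
    (hSn : (2 * ε / d) ^ 2 * frob S S ≤ 1 / 100) :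
    ENNReal.ofReal (v * Real.exp (ε ^ 2 / d * (frob S S - v⁻¹ * ∑ t, frob (center (y t)) (center (y t)))
      - ε ^ 2 * (2 * ε / d) ^ 2 * ∑ t, frob S (center (y t)) ^ 2
      - 20512 * (n * ε ^ 3 / (d * Real.sqrt d)) * v⁻¹)) ≤
    ∫⁻ g in truncatedEntries d, ENNReal.ofReal (∏ t, (1 + ε * frob (goeMat g) (y t)))
      ∂(goeEntries d) := by
  have hd' : (0 : ℝ) < d := by positivity
  set r := Real.sqrt d with hr
  have hr0 : 0 < r := Real.sqrt_pos.2 hd'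
  have hrr : r * r = d := Real.mul_self_sqrt hd'.le
  have hys : ∀ t, (y t).IsSymm := fun t => by
    have := (hy t).1; rwa [Matrix.IsHermitian, Matrix.conjTranspose_eq_transpose_of_trivial] at this
  set H := (2 * ε / d) • S with hH
  have hSs : S.IsSymm := by
    rw [hS, Matrix.IsSymm, Matrix.transpose_sum]
    exact Finset.sum_congr rfl fun t _ => center_isSymm (hys t)
  have hStr : S.trace = 0 := by
    rw [hS, Matrix.trace_sum]; exact Finset.sum_eq_zero fun t _ => trace_center _
  have hHs : H.IsSymm := hSs.smul _
  have hHtr : H.trace = 0 := by rw [hH, Matrix.trace_smul, hStr, smul_zero]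
  have hHn : frob H H ≤ 1 / 100 := by
    rw [hH, frob_smul_left, frob_smul_right]; linarith [hSn]
  set V := typicalSet d with hVdef
  set γ := goeEntries d with hγ
  have hV0 : γ V ≠ 0 := fun h => by
    rw [hv, Measure.real, h] at hv0; simp at hv0
  set h : Fin n → ℝ := fun t => frob H (y t) with hh
  set a : Fin n → (Sym2 (Fin d) → ℝ) → ℝ := fun t g => frob (goeMat g) (y t) with ha
  have hQ : ∀ t, frob (center (y t)) (center (y t)) ≤ 4 := fun t =>
    frob_center_center_le_four (hy t) (htr t)
  have hhsq : ∀ t, h t ^ 2 ≤ 1 / 25 := by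
    intro t
    have h1 : h t = frob H (center (y t)) := by
      rw [hh, ← frob_center_left, center_of_trace_eq_zero hHtr]
    rw [h1]
    refine (frob_sq_le _ _).trans ?_
    nlinarith [hQ t, frob_self_nonneg H, frob_self_nonneg (center (y t))]
  set A2 := ε ^ 2 / 2 + 4 * ε ^ 3 * r⁻¹ with hA2
  set A4 := 4 * ε ^ 3 * r with hA4
  have hA2' : 0 ≤ A2 := by positivity
  have hA4' : 0 ≤ A4 := by positivity
  -- The exponent after translation splits into a constant `c0`, an odd part `ℓ` that vanishes in
  -- the mean, and an even part `q` that is bounded by its moments.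
  set c0 := (∑ t, (ε * h t - ε ^ 2 * h t ^ 2)) - d / 4 * frob H H with hc0
  set ℓ : (Sym2 (Fin d) → ℝ) → ℝ := fun g =>
    (∑ t, (ε - ε ^ 2 * h t) * a t g) - d / 2 * frob (goeMat g) H with hℓ
  set q : (Sym2 (Fin d) → ℝ) → ℝ := fun g => ∑ t, (A2 * a t g ^ 2 + A4 * a t g ^ 4) with hq
  have hpoint : ∀ g ∈ V, ENNReal.ofReal (Real.exp (c0 + ℓ g - q g)) ≤
      ENNReal.ofReal (Real.exp (∑ p, (-(entry H p * g p / goeVar d p) -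
        entry H p ^ 2 / (2 * goeVar d p)))) *
      (truncatedEntries d).indicator
        (fun g => ENNReal.ofReal (∏ t, (1 + ε * frob (goeMat g) (y t)))) (g + entry H) := by
    intro g hg
    have hmem := add_entry_mem_truncatedEntries hd hg hHs hHtr hHn
    rw [Set.indicator_of_mem hmem, sum_shift_exponent hd hHs hHtr, goeMat_add_entry hHs hHtr,
      ← ENNReal.ofReal_mul (Real.exp_pos _).le]
    refine ENNReal.ofReal_le_ofReal ?_
    have hsplit : c0 + ℓ g - q g = (-(d / 2 * frob (goeMat g) H) - d / 4 * frob H H) +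
        ∑ t, ((ε * h t - ε ^ 2 * h t ^ 2) + (ε - ε ^ 2 * h t) * a t g -
          (A2 * a t g ^ 2 + A4 * a t g ^ 4)) := by
      rw [Finset.sum_sub_distrib, Finset.sum_add_distrib, hc0, hℓ, hq]; ring
    rw [hsplit, Real.exp_add, Real.exp_sum]
    refine mul_le_mul_of_nonneg_left ?_ (Real.exp_pos _).le
    refine Finset.prod_le_prod (fun t _ => (Real.exp_pos _).le) fun t _ => ?_
    rw [frob_add_left]
    refine exp_expansion_le_one_add hε hε' hr0 ?_ (hhsq t)
    have h1 := (hy t).abs_frob_le hmem.1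
    rw [goeMat_add_entry hHs hHtr, frob_add_left] at h1
    rw [abs_mul, abs_of_nonneg hε]
    have h2 : |frob (goeMat g) (y t) + frob H (y t)| ≤ 6 := h1.trans (by linarith [htr t])
    calc ε * |frob (goeMat g) (y t) + frob H (y t)| ≤ 1 / 12 * 6 :=
          mul_le_mul hε' h2 (abs_nonneg _) (by norm_num)
      _ = _ := by norm_num
  have hmeasF : Measurable ((truncatedEntries d).indicator
      fun g => ENNReal.ofReal (∏ t, (1 + ε * frob (goeMat g) (y t)))) := by
    refine Measurable.indicator (Continuous.measurable ?_).ennreal_ofReal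
      (measurableSet_truncatedEntries d)
    exact continuous_finsetProd _ fun t _ => continuous_const.add (continuous_const.mul
      (continuous_frob.comp (continuous_goeMat.prodMk continuous_const)))
  -- integrals of the terms of the exponent
  have haf : ∀ t g, a t g = ∑ p, goeCoeff (y t) p * g p := fun t g => frob_goeMat (hys t) g
  have hIa2 : ∀ t, Integrable (fun g => a t g ^ 2) γ := fun t => by
    simp_rw [haf]; exact (memLp_linear_pi _ _ 2 (by simp)).integrable_sq
  have hIa4 : ∀ t, Integrable (fun g => a t g ^ 4) γ := fun t => by
    simp_rw [haf]; exact integrable_linear_pow_four_pi _ _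
  have hIa : ∀ t, Integrable (a t) γ := fun t => by
    have : a t = fun g => ∑ p, goeCoeff (y t) p * g p := funext (haf t)
    rw [this]; exact (memLp_linear_pi _ _ 1 (by simp)).integrable le_rfl
  have hIH : Integrable (fun g : Sym2 (Fin d) → ℝ => frob (goeMat g) H) γ := by
    simp_rw [frob_goeMat hHs]; exact (memLp_linear_pi _ _ 1 (by simp)).integrable le_rfl
  have hIℓ : Integrable ℓ γ :=
    (integrable_finsetSum _ fun t _ => (hIa t).const_mul _).sub (hIH.const_mul _)
  have hIq : Integrable q γ := integrable_finsetSum _ fun t _ =>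
    ((hIa2 t).const_mul _).add ((hIa4 t).const_mul _)
  have hodd : ∫ g, ℓ g ∂(cond γ V) = 0 := by
    rw [integral_cond_typicalSet, setIntegral_typicalSet_of_odd, mul_zero]
    intro g
    have hneg : ∀ X, frob (goeMat (-g)) X = -frob (goeMat g) X := fun X => by
      rw [goeMat_neg]; simp [frob]
    simp only [hℓ, ha, hneg, mul_neg, Finset.sum_neg_distrib]; ring
  have hE2 : ∀ t, ∫ g, a t g ^ 2 ∂(cond γ V) ≤ v⁻¹ * (2 / d * frob (center (y t)) (center (y t))) := by
    intro t
    rw [hv]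
    refine integral_cond_typicalSet_le (hIa2 t) (fun g => sq_nonneg _) (le_of_eq ?_)
    simp_rw [haf]
    rw [integral_linear_sq_pi, sum_goeCoeff_sq (hys t)]
  have hE4 : ∀ t, ∫ g, a t g ^ 4 ∂(cond γ V) ≤ v⁻¹ * (80 * (8 / d) ^ 2) := by
    intro t
    rw [hv]
    refine integral_cond_typicalSet_le (hIa4 t) (fun g => by positivity) ?_
    simp_rw [haf]
    refine integral_linear_pow_four_pi_le _ _ (by positivity) ?_
    rw [sum_goeCoeff_sq (hys t)]
    calc 2 / (d : ℝ) * frob (center (y t)) (center (y t)) ≤ 2 / d * 4 := by gcongr; exact hQ t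
      _ = 8 / d := by ring
  have hEq : ∫ g, q g ∂(cond γ V) ≤ ε ^ 2 / d * (v⁻¹ * ∑ t, frob (center (y t)) (center (y t))) +
      20512 * (n * ε ^ 3 / (d * r)) * v⁻¹ := by
    -- The coefficient is `32 + 4 · 80 · 64 = 20512`, from the second and fourth moment parts of the
    -- cubic error, using `r² = d`.
    have hterm : ∀ t, ∫ g, (A2 * a t g ^ 2 + A4 * a t g ^ 4) ∂(cond γ V) ≤
        ε ^ 2 / d * (v⁻¹ * frob (center (y t)) (center (y t))) +
          20512 * (ε ^ 3 / (d * r)) * v⁻¹ := by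
      intro t
      rw [integral_add ((integrable_cond_typicalSet (hIa2 t) hV0).const_mul _)
        ((integrable_cond_typicalSet (hIa4 t) hV0).const_mul _), integral_const_mul,
        integral_const_mul]
      have hQt : v⁻¹ * (2 / d * frob (center (y t)) (center (y t))) ≤ v⁻¹ * (8 / d) := by
        gcongr
        calc 2 / (d : ℝ) * frob (center (y t)) (center (y t)) ≤ 2 / d * 4 := by
              gcongr; exact hQ t
          _ = 8 / d := by ring
      calc A2 * ∫ g, a t g ^ 2 ∂(cond γ V) + A4 * ∫ g, a t g ^ 4 ∂(cond γ V)
          ≤ A2 * (v⁻¹ * (2 / d * frob (center (y t)) (center (y t)))) +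
            A4 * (v⁻¹ * (80 * (8 / d) ^ 2)) := by
              gcongr
              · exact hE2 t
              · exact hE4 t
        _ = ε ^ 2 / 2 * (v⁻¹ * (2 / d * frob (center (y t)) (center (y t)))) +
            4 * ε ^ 3 * r⁻¹ * (v⁻¹ * (2 / d * frob (center (y t)) (center (y t)))) +
            A4 * (v⁻¹ * (80 * (8 / d) ^ 2)) := by rw [hA2]; ring
        _ ≤ ε ^ 2 / 2 * (v⁻¹ * (2 / d * frob (center (y t)) (center (y t)))) +
            4 * ε ^ 3 * r⁻¹ * (v⁻¹ * (8 / d)) + A4 * (v⁻¹ * (80 * (8 / d) ^ 2)) := by gcongr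
        _ = _ := by
            rw [hA4, ← hrr]; field_simp; ring
    refine (integral_finsetSum Finset.univ
      (f := fun t g => A2 * a t g ^ 2 + A4 * a t g ^ 4) fun t _ =>
      ((integrable_cond_typicalSet (hIa2 t) hV0).const_mul _).add
        ((integrable_cond_typicalSet (hIa4 t) hV0).const_mul _)).trans_le ?_
    refine (Finset.sum_le_sum fun t _ => hterm t).trans (le_of_eq ?_)
    rw [Finset.sum_add_distrib, ← Finset.mul_sum, ← Finset.mul_sum, Finset.sum_const,
      Finset.card_univ, Fintype.card_fin, nsmul_eq_mul]
    ring
  -- The linear gain `(2ε²/d)‖S‖²` minus the translation cost `(d/4)‖H‖² = (ε²/d)‖S‖²`.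
  have hc0' : c0 = ε ^ 2 / d * frob S S - ε ^ 2 * (2 * ε / d) ^ 2 *
      ∑ t, frob S (center (y t)) ^ 2 := by
    have h1 : ∀ t, h t = 2 * ε / d * frob S (center (y t)) := fun t => by
      simp only [hh, hH]
      rw [frob_smul_left, ← frob_center_left, center_of_trace_eq_zero hStr]
    have h2 : ∑ t, frob S (center (y t)) = frob S S := by
      rw [← frob_sum_right, ← hS]
    have h3 : frob H H = (2 * ε / d) ^ 2 * frob S S := by
      rw [hH, frob_smul_left, frob_smul_right]; ring
    simp_rw [hc0, h1, h3, Finset.sum_sub_distrib, mul_pow]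
    rw [← Finset.mul_sum, ← Finset.mul_sum, ← Finset.mul_sum, ← Finset.mul_sum, h2]
    field_simp
    ring
  have : IsProbabilityMeasure (cond γ V) := cond_isProbabilityMeasure hV0
  have hIφ : Integrable (fun g => c0 + ℓ g - q g) (cond γ V) :=
    ((integrable_const _).add (integrable_cond_typicalSet hIℓ hV0)).sub
      (integrable_cond_typicalSet hIq hV0)
  have hIcℓ : Integrable (fun g => c0 + ℓ g) (cond γ V) :=
    (integrable_const _).add (integrable_cond_typicalSet hIℓ hV0)
  have hEφ : ∫ g, (c0 + ℓ g - q g) ∂(cond γ V) = c0 - ∫ g, q g ∂(cond γ V) := by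
    rw [integral_sub hIcℓ (integrable_cond_typicalSet hIq hV0),
      integral_add (integrable_const _) (integrable_cond_typicalSet hIℓ hV0), hodd]
    simp
  have hγV : γ V = ENNReal.ofReal v := by rw [hv, Measure.real, ENNReal.ofReal_toReal (measure_ne_top _ _)]
  calc _ ≤ ENNReal.ofReal (v * Real.exp (∫ g, (c0 + ℓ g - q g) ∂(cond γ V))) := by
        refine ENNReal.ofReal_le_ofReal (mul_le_mul_of_nonneg_left (Real.exp_le_exp.2 ?_) hv0.le)
        rw [hEφ, hc0', mul_sub]
        linarith [hEq]
    _ = γ V * ENNReal.ofReal (Real.exp (∫ g, (c0 + ℓ g - q g) ∂(cond γ V))) := by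
        rw [hγV, ENNReal.ofReal_mul hv0.le]
    _ ≤ γ V * ∫⁻ g, ENNReal.ofReal (Real.exp (c0 + ℓ g - q g)) ∂(cond γ V) := by
        gcongr; exact ofReal_exp_integral_le_lintegral _ _ hIφ
    _ = ∫⁻ g in V, ENNReal.ofReal (Real.exp (c0 + ℓ g - q g)) ∂γ := by
        rw [ProbabilityTheory.cond, lintegral_smul_measure, smul_eq_mul, ← mul_assoc,
          ENNReal.mul_inv_cancel hV0 (measure_ne_top _ _), one_mul]
    _ ≤ ∫⁻ g in V, (ENNReal.ofReal (Real.exp (∑ p, (-(entry H p * g p / goeVar d p) -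
        entry H p ^ 2 / (2 * goeVar d p)))) *
      (truncatedEntries d).indicator
        (fun g => ENNReal.ofReal (∏ t, (1 + ε * frob (goeMat g) (y t)))) (g + entry H)) ∂γ :=
        setLIntegral_mono' (measurableSet_typicalSet d) hpoint
    _ ≤ ∫⁻ g, (ENNReal.ofReal (Real.exp (∑ p, (-(entry H p * g p / goeVar d p) -
        entry H p ^ 2 / (2 * goeVar d p)))) *
      (truncatedEntries d).indicator
        (fun g => ENNReal.ofReal (∏ t, (1 + ε * frob (goeMat g) (y t)))) (g + entry H)) ∂γ :=
        setLIntegral_le_lintegral _ _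
    _ = ∫⁻ g, (truncatedEntries d).indicator
        (fun g => ENNReal.ofReal (∏ t, (1 + ε * frob (goeMat g) (y t)))) g ∂γ :=
        (lintegral_pi_gaussian_shift (goeVar d) (goeVar_ne_zero hd) (entry H) _ hmeasF).symm
    _ = _ := lintegral_indicator (measurableSet_truncatedEntries d) _

end LikelihoodRatio

/-! ### Matrix martingales on the tree. -/

section Tree

variable {n : ℕ} {Z : Type}

/-- The outcomes observed before step `t`. -/
def pathHistory (x : Fin n → Z) (t : Fin n) : Fin t → Z := fun j => x (Fin.castLE t.isLt.le j)

/-- The probability of a path, given the conditional probabilities of its steps. -/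
def pathWeight (q : (t : Fin n) → (Fin t → Z) → Z → ℝ) (x : Fin n → Z) : ℝ :=
  ∏ t, q t (pathHistory x t) (x t)

/-- A quantity attached to the edges of a tree, at step `t` of a path. -/
def pathValue {E : Type*} (Y : (t : Fin n) → (Fin t → Z) → Z → E) (x : Fin n → Z) (t : Fin n) : E :=
  Y t (pathHistory x t) (x t)

/-- The restriction to all steps but the last. -/
def treeInit {E : Type*} (Y : (t : Fin (n + 1)) → (Fin t → Z) → Z → E) :
    (t : Fin n) → (Fin t → Z) → Z → E := fun t h z => Y t.castSucc h z

lemma pathHistory_snoc_castSucc (x : Fin n → Z) (z : Z) (t : Fin n) :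
    pathHistory (Fin.snoc x z : Fin (n + 1) → Z) t.castSucc = pathHistory x t := by
  funext j
  exact Fin.snoc_castSucc (α := fun _ => Z) z x (Fin.castLE t.isLt.le j)

lemma pathHistory_snoc_last (x : Fin n → Z) (z : Z) :
    pathHistory (Fin.snoc x z : Fin (n + 1) → Z) (Fin.last n) = x := by
  funext j
  exact Fin.snoc_castSucc (α := fun _ => Z) z x j

lemma pathValue_snoc_castSucc {E : Type*} (Y : (t : Fin (n + 1)) → (Fin t → Z) → Z → E)
    (x : Fin n → Z) (z : Z) (t : Fin n) :
    pathValue Y (Fin.snoc x z : Fin (n + 1) → Z) t.castSucc = pathValue (treeInit Y) x t := by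
  rw [pathValue, pathHistory_snoc_castSucc, Fin.snoc_castSucc]; rfl

lemma pathValue_snoc_last {E : Type*} (Y : (t : Fin (n + 1)) → (Fin t → Z) → Z → E)
    (x : Fin n → Z) (z : Z) :
    pathValue Y (Fin.snoc x z : Fin (n + 1) → Z) (Fin.last n) = Y (Fin.last n) x z := by
  rw [pathValue, pathHistory_snoc_last, Fin.snoc_last]

lemma sum_pathValue_snoc {d : ℕ}
    (Y : (t : Fin (n + 1)) → (Fin t → Z) → Z → Matrix (Fin d) (Fin d) ℝ)
    (x : Fin n → Z) (z : Z) :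
    ∑ t, pathValue Y (Fin.snoc x z : Fin (n + 1) → Z) t =
      ∑ t, pathValue (treeInit Y) x t + Y (Fin.last n) x z := by
  rw [Fin.sum_univ_castSucc, pathValue_snoc_last]
  simp_rw [pathValue_snoc_castSucc]

variable [Fintype Z]

/-- Conditioning on all outcomes but the last; every induction on the depth below rests on it. -/
lemma sum_pathWeight_succ (q : (t : Fin (n + 1)) → (Fin t → Z) → Z → ℝ)
    (f : (Fin (n + 1) → Z) → ℝ) :
    ∑ x, pathWeight q x * f x =
      ∑ x, pathWeight (treeInit q) x * ∑ z, q (Fin.last n) x z * f (Fin.snoc x z) := by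
  rw [← (Fin.snocEquiv fun _ => Z).sum_comp, Fintype.sum_prod_type, Finset.sum_comm]
  refine Finset.sum_congr rfl fun x _ => ?_
  rw [Finset.mul_sum]
  refine Finset.sum_congr rfl fun z _ => ?_
  have h : pathWeight q ((Fin.snocEquiv fun _ => Z) (z, x)) =
      pathWeight (treeInit q) x * q (Fin.last n) x z := by
    change ∏ t, pathValue q (Fin.snoc x z : Fin (n + 1) → Z) t = _
    rw [Fin.prod_univ_castSucc, pathValue_snoc_last]
    simp_rw [pathValue_snoc_castSucc]
    rfl
  rw [h, mul_assoc]; rfl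

lemma sum_pathWeight_eq_one (q : (t : Fin n) → (Fin t → Z) → Z → ℝ)
    (h : ∀ t p, ∑ z, q t p z = 1) : ∑ x, pathWeight q x = 1 := by
  induction n with
  | zero => simp [pathWeight]
  | succ n ih =>
    have := sum_pathWeight_succ q fun _ => 1
    simp only [mul_one, h] at this
    rw [this, ih (treeInit q) fun t p => h t.castSucc p]

variable {d : ℕ}

/-- Conditional probabilities `q` on a tree, and matrices on its edges that are bounded martingale
differences whose conditional covariances are bounded by `κ`. -/
structure IsTreeMartingale (q : (t : Fin n) → (Fin t → Z) → Z → ℝ)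
    (Y : (t : Fin n) → (Fin t → Z) → Z → Matrix (Fin d) (Fin d) ℝ) (κ : ℝ) : Prop where
  nonneg : ∀ t h z, 0 ≤ q t h z
  sum_eq_one : ∀ t h, ∑ z, q t h z = 1
  mean_eq_zero : ∀ t h v, ∑ z, q t h z * frob v (Y t h z) = 0
  norm_le : ∀ t h z, frob (Y t h z) (Y t h z) ≤ 4
  covariance_le : ∀ t h v, ∑ z, q t h z * frob v (Y t h z) ^ 2 ≤ κ * frob v v

namespace IsTreeMartingale

variable {κ : ℝ}

lemma init {q : (t : Fin (n + 1)) → (Fin t → Z) → Z → ℝ}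
    {Y : (t : Fin (n + 1)) → (Fin t → Z) → Z → Matrix (Fin d) (Fin d) ℝ}
    (h : IsTreeMartingale q Y κ) : IsTreeMartingale (treeInit q) (treeInit Y) κ where
  nonneg t := h.nonneg t.castSucc
  sum_eq_one t := h.sum_eq_one t.castSucc
  mean_eq_zero t := h.mean_eq_zero t.castSucc
  norm_le t := h.norm_le t.castSucc
  covariance_le t := h.covariance_le t.castSucc

variable {q : (t : Fin n) → (Fin t → Z) → Z → ℝ}
  {Y : (t : Fin n) → (Fin t → Z) → Z → Matrix (Fin d) (Fin d) ℝ}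

lemma pathWeight_nonneg (h : IsTreeMartingale q Y κ) (x : Fin n → Z) : 0 ≤ pathWeight q x :=
  Finset.prod_nonneg fun _ _ => h.nonneg _ _ _

lemma sum_pathWeight (h : IsTreeMartingale q Y κ) : ∑ x, pathWeight q x = 1 :=
  sum_pathWeight_eq_one q h.sum_eq_one

/-- One step of a bound for a mean over the paths. -/
lemma sum_le_of_step {q : (t : Fin (n + 1)) → (Fin t → Z) → Z → ℝ}
    {Y : (t : Fin (n + 1)) → (Fin t → Z) → Z → Matrix (Fin d) (Fin d) ℝ}
    (h : IsTreeMartingale q Y κ) {f : (Fin (n + 1) → Z) → ℝ} {g : (Fin n → Z) → ℝ} {b : ℝ}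
    (hstep : ∀ x, ∑ z, q (Fin.last n) x z * f (Fin.snoc x z) ≤ g x)
    (hb : ∑ x, pathWeight (treeInit q) x * g x ≤ b) : ∑ x, pathWeight q x * f x ≤ b := by
  rw [sum_pathWeight_succ]
  exact (Finset.sum_le_sum fun x _ =>
    mul_le_mul_of_nonneg_left (hstep x) (h.init.pathWeight_nonneg x)).trans hb

lemma frob_add_add_self (X X' : Matrix (Fin d) (Fin d) ℝ) :
    frob (X + X') (X + X') = frob X X + 2 * frob X X' + frob X' X' := by
  rw [frob_add_left, frob_add_right, frob_add_right, frob_comm X' X]; ring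

lemma sum_mul_const (h : IsTreeMartingale q Y κ) (t : Fin n) (p : Fin t → Z) (c : ℝ) :
    ∑ z, q t p z * c = c := by
  rw [← Finset.sum_mul, h.sum_eq_one, one_mul]

lemma mean_normSq_le (h : IsTreeMartingale q Y κ) :
    ∑ x, pathWeight q x * frob (∑ t, pathValue Y x t) (∑ t, pathValue Y x t) ≤ 4 * n := by
  induction n with
  | zero => simp [frob]
  | succ n ih =>
    refine h.sum_le_of_step (g := fun x => frob (∑ t, pathValue (treeInit Y) x t)
      (∑ t, pathValue (treeInit Y) x t) + 4) (fun x => ?_) ?_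
    · simp_rw [sum_pathValue_snoc, frob_add_add_self]
      set S := ∑ t, pathValue (treeInit Y) x t
      have h1 := h.mean_eq_zero (Fin.last n) x S
      calc _ ≤ ∑ z, (q (Fin.last n) x z * (frob S S + 4) +
              2 * (q (Fin.last n) x z * frob S (Y (Fin.last n) x z))) := by
            refine Finset.sum_le_sum fun z _ => ?_
            have := mul_le_mul_of_nonneg_left (h.norm_le (Fin.last n) x z)
              (h.nonneg (Fin.last n) x z)
            linarith
        _ = _ := by
            rw [Finset.sum_add_distrib, h.sum_mul_const, ← Finset.mul_sum, h1]; ring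
    · simp_rw [mul_add]
      rw [Finset.sum_add_distrib, ← Finset.sum_mul, h.init.sum_pathWeight]
      push_cast
      linarith [ih h.init]

/-- The last step adds `2⟨S, Y⟩`, which has conditional mean zero, so second moments add. The
increment is at most `4κ E‖S‖² ≤ 16κm` at depth `m`, and these sum to at most `8κn²`. -/
lemma mean_crossTerm_sq_le (h : IsTreeMartingale q Y κ) (hκ : 0 ≤ κ) :
    ∑ x, pathWeight q x * (frob (∑ t, pathValue Y x t) (∑ t, pathValue Y x t) -
      ∑ t, frob (pathValue Y x t) (pathValue Y x t)) ^ 2 ≤ 8 * κ * n ^ 2 := by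
  induction n with
  | zero => simp [frob]
  | succ n ih =>
    refine h.sum_le_of_step (g := fun x => (frob (∑ t, pathValue (treeInit Y) x t)
      (∑ t, pathValue (treeInit Y) x t) - ∑ t, frob (pathValue (treeInit Y) x t)
        (pathValue (treeInit Y) x t)) ^ 2 + 4 * κ * frob (∑ t, pathValue (treeInit Y) x t)
      (∑ t, pathValue (treeInit Y) x t)) (fun x => ?_) ?_
    · simp_rw [sum_pathValue_snoc, frob_add_add_self, Fin.sum_univ_castSucc, pathValue_snoc_castSucc,
        pathValue_snoc_last]
      set S := ∑ t, pathValue (treeInit Y) x t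
      set Q := ∑ t, frob (pathValue (treeInit Y) x t) (pathValue (treeInit Y) x t)
      have h1 := h.mean_eq_zero (Fin.last n) x S
      have h2 := h.covariance_le (Fin.last n) x S
      calc _ = ∑ z, (q (Fin.last n) x z * (frob S S - Q) ^ 2 +
              4 * (frob S S - Q) * (q (Fin.last n) x z * frob S (Y (Fin.last n) x z)) +
              4 * (q (Fin.last n) x z * frob S (Y (Fin.last n) x z) ^ 2)) :=
            Finset.sum_congr rfl fun z _ => by ring
        _ ≤ _ := by
            rw [Finset.sum_add_distrib, Finset.sum_add_distrib, h.sum_mul_const, ← Finset.mul_sum,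
              ← Finset.mul_sum, h1]
            linarith
    · simp_rw [mul_add, mul_left_comm _ (4 * κ)]
      rw [Finset.sum_add_distrib, ← Finset.mul_sum]
      have h1 := ih h.init
      have h2 := mul_le_mul_of_nonneg_left h.init.mean_normSq_le (by linarith : 0 ≤ 4 * κ)
      push_cast
      nlinarith

/-- At depth `m`, each of the `m` old terms grows by at most `4κ` in the mean, since its cross term
vanishes. The new term is at most `2⟨S, Y⟩² + 32`, of mean at most `8κm + 32`. Summing `12κm + 32`
gives the bound. -/
lemma mean_sum_frob_sq_le (h : IsTreeMartingale q Y κ) (hκ : 0 ≤ κ) :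
    ∑ x, pathWeight q x * ∑ t, frob (∑ s, pathValue Y x s) (pathValue Y x t) ^ 2 ≤
      6 * κ * n ^ 2 + 32 * n := by
  induction n with
  | zero => simp
  | succ n ih =>
    refine h.sum_le_of_step (g := fun x =>
      (∑ t, frob (∑ s, pathValue (treeInit Y) x s) (pathValue (treeInit Y) x t) ^ 2) +
        2 * κ * frob (∑ t, pathValue (treeInit Y) x t) (∑ t, pathValue (treeInit Y) x t) +
        (4 * κ * n + 32)) (fun x => ?_) ?_
    · simp_rw [sum_pathValue_snoc, Fin.sum_univ_castSucc, pathValue_snoc_castSucc,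
        pathValue_snoc_last]
      set S := ∑ t, pathValue (treeInit Y) x t with hS
      set P := fun t => pathValue (treeInit Y) x t with hP
      have hlast : ∀ z, frob (S + Y (Fin.last n) x z) (Y (Fin.last n) x z) ^ 2 ≤
          2 * frob S (Y (Fin.last n) x z) ^ 2 + 32 := by
        intro z
        rw [frob_add_left]
        have h1 := h.norm_le (Fin.last n) x z
        have h2 := frob_self_nonneg (Y (Fin.last n) x z)
        nlinarith [sq_nonneg (frob S (Y (Fin.last n) x z) -
          frob (Y (Fin.last n) x z) (Y (Fin.last n) x z))]
      have hold : ∀ t, ∑ z, q (Fin.last n) x z * frob (S + Y (Fin.last n) x z) (P t) ^ 2 ≤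
          frob S (P t) ^ 2 + 4 * κ := by
        intro t
        have h1 := h.mean_eq_zero (Fin.last n) x (P t)
        have h2 := h.covariance_le (Fin.last n) x (P t)
        have h3 : frob (P t) (P t) ≤ 4 := h.init.norm_le _ _ _
        calc _ = ∑ z, (q (Fin.last n) x z * frob S (P t) ^ 2 +
              2 * frob S (P t) * (q (Fin.last n) x z * frob (P t) (Y (Fin.last n) x z)) +
              q (Fin.last n) x z * frob (P t) (Y (Fin.last n) x z) ^ 2) :=
              Finset.sum_congr rfl fun z _ => by
                rw [frob_add_left, frob_comm (Y (Fin.last n) x z)]; ring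
          _ ≤ _ := by
              rw [Finset.sum_add_distrib, Finset.sum_add_distrib, h.sum_mul_const,
                ← Finset.mul_sum, h1]
              nlinarith
      calc _ ≤ ∑ z, (∑ t, q (Fin.last n) x z * frob (S + Y (Fin.last n) x z) (P t) ^ 2 +
              (2 * (q (Fin.last n) x z * frob S (Y (Fin.last n) x z) ^ 2) +
                q (Fin.last n) x z * 32)) := by
            refine Finset.sum_le_sum fun z _ => ?_
            rw [mul_add, Finset.mul_sum]
            have := mul_le_mul_of_nonneg_left (hlast z) (h.nonneg (Fin.last n) x z)
            linarith
        _ ≤ ∑ t, (frob S (P t) ^ 2 + 4 * κ) + (2 * (κ * frob S S) + 32) := by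
            rw [Finset.sum_add_distrib, Finset.sum_add_distrib, Finset.sum_comm, h.sum_mul_const,
              ← Finset.mul_sum]
            exact add_le_add (Finset.sum_le_sum fun t _ => hold t)
              (by linarith [h.covariance_le (Fin.last n) x S])
        _ = _ := by
            rw [Finset.sum_add_distrib, Finset.sum_const, Finset.card_univ, Fintype.card_fin,
              nsmul_eq_mul]
            ring
    · simp_rw [mul_add _ _ (4 * κ * (n : ℝ) + 32), mul_add (pathWeight (treeInit q) _),
        mul_left_comm _ (2 * κ)]
      rw [Finset.sum_add_distrib, Finset.sum_add_distrib, Finset.sum_add_distrib,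
        ← Finset.mul_sum, ← Finset.sum_mul, ← Finset.sum_mul, h.init.sum_pathWeight]
      have h1 := ih h.init
      have h2 := mul_le_mul_of_nonneg_left h.init.mean_normSq_le (by linarith : 0 ≤ 2 * κ)
      push_cast
      nlinarith

end IsTreeMartingale

end Tree

/-! ### Normalized POVM elements form a tree martingale. -/

section Povm

open Matrix

variable {d n : ℕ} {Z : Type} [Fintype Z] {a : Fin d → ℝ}

/-- Averaging `a i ≤ 2 a j` over `i`: the mean of the `a i` is `1`. -/
lemma IsReference.half_le (ha : IsReference a) (j : Fin d) : 1 / 2 ≤ a j := by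
  have hd : (0 : ℝ) < d := by exact_mod_cast (Fin.pos j)
  have h : ∑ i, a i ≤ ∑ _i : Fin d, 2 * a j := Finset.sum_le_sum fun i _ => ha.comparable i j
  rw [ha.trace_eq, Finset.sum_const, Finset.card_univ, Fintype.card_fin, nsmul_eq_mul] at h
  have : 1 ≤ 2 * a j := le_of_mul_le_mul_left (by linarith) hd
  linarith

lemma frob_diagonal (a : Fin d → ℝ) (B : Matrix (Fin d) (Fin d) ℝ) :
    frob (Matrix.diagonal a) B = ∑ i, a i * B i i := by
  simp [frob, Matrix.diagonal_apply]

lemma IsReference.trace_le (ha : IsReference a) {B : Matrix (Fin d) (Fin d) ℝ}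
    (hB : B.PosSemidef) : B.trace ≤ 2 * frob (Matrix.diagonal a) B := by
  rw [frob_diagonal, Matrix.trace, Finset.mul_sum]
  refine Finset.sum_le_sum fun i _ => ?_
  have := hB.diag_nonneg (i := i)
  simp only [Matrix.diag_apply]
  nlinarith [ha.half_le i]

lemma IsReference.frob_diagonal_nonneg (ha : IsReference a) {B : Matrix (Fin d) (Fin d) ℝ}
    (hB : B.PosSemidef) : 0 ≤ frob (Matrix.diagonal a) B := by
  have := ha.trace_le hB
  have := hB.trace_nonneg
  linarith

lemma IsReference.eq_zero_of_frob_diagonal (ha : IsReference a) {B : Matrix (Fin d) (Fin d) ℝ}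
    (hB : B.PosSemidef) (h : frob (Matrix.diagonal a) B = 0) : B = 0 := by
  have h1 := ha.trace_le hB
  have h2 := hB.trace_nonneg
  have h3 : B.trace = 0 := by linarith
  exact hB.trace_eq_zero_iff.1 h3

/-- The real part of a POVM element. -/
def POVM.reElem (P : POVM d Z) (z : Z) : Matrix (Fin d) (Fin d) ℝ := rePart (P.elem z)

lemma POVM.reElem_posSemidef (P : POVM d Z) (z : Z) : (P.reElem z).PosSemidef :=
  rePart_posSemidef (P.posSemidef z)

lemma POVM.sum_reElem (P : POVM d Z) : ∑ z, P.reElem z = 1 := by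
  ext i j
  have h := congrArg Complex.re (congrFun (congrFun P.sum_elem i) j)
  rw [Matrix.sum_apply, Complex.re_sum] at h
  rw [Matrix.sum_apply]
  refine h.trans ?_
  by_cases hij : i = j <;> simp [Matrix.one_apply, hij]

lemma POVM.prob_map (P : POVM d Z) (R : Matrix (Fin d) (Fin d) ℝ) (z : Z) :
    P.prob (R.map fun r : ℝ => (r : ℂ)) z = frob R (P.reElem z) :=
  re_trace_map_mul (P.posSemidef z) R

lemma POVM.sum_prob_map (P : POVM d Z) (R : Matrix (Fin d) (Fin d) ℝ) :
    ∑ z, P.prob (R.map fun r : ℝ => (r : ℂ)) z = R.trace := by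
  simp_rw [P.prob_map]
  rw [← frob_sum_right, P.sum_reElem, frob_one_right]

/-- A POVM element, normalized by its probability under the null hypothesis. -/
noncomputable def POVM.normalized (P : POVM d Z) (a : Fin d → ℝ) (z : Z) :
    Matrix (Fin d) (Fin d) ℝ :=
  (frob (Matrix.diagonal a) (P.reElem z))⁻¹ • P.reElem z

lemma POVM.prob_nullState (P : POVM d Z) (a : Fin d → ℝ) (z : Z) :
    P.prob (nullState a) z = 1 / d * frob (Matrix.diagonal a) (P.reElem z) := by
  rw [nullState, P.prob_map, frob_smul_left]

/-- This also covers outcomes of null probability zero: there the element itself has zero real part,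
since `A` is bounded below, so the convention `0⁻¹ = 0` is harmless. -/
lemma POVM.prob_nullState_smul_normalized (P : POVM d Z) (ha : IsReference a) (z : Z) :
    P.prob (nullState a) z • P.normalized a z = (1 / (d : ℝ)) • P.reElem z := by
  rw [P.prob_nullState, POVM.normalized, smul_smul]
  by_cases h : frob (Matrix.diagonal a) (P.reElem z) = 0
  · rw [ha.eq_zero_of_frob_diagonal (P.reElem_posSemidef z) h]; simp
  · rw [mul_assoc, mul_inv_cancel₀ h, mul_one]

lemma POVM.prob_perturbedState (P : POVM d Z) (ha : IsReference a) (ε : ℝ)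
    (M : Matrix (Fin d) (Fin d) ℝ) (z : Z) :
    P.prob (perturbedState a ε M) z =
      P.prob (nullState a) z * (1 + ε * frob M (P.normalized a z)) := by
  have h := congrArg (frob M) (P.prob_nullState_smul_normalized ha z)
  rw [frob_smul_right, frob_smul_right] at h
  rw [perturbedState, P.prob_map, frob_smul_left, frob_add_left, frob_smul_left,
    mul_add (P.prob (nullState a) z), mul_left_comm _ ε, h, P.prob_nullState]
  ring

lemma POVM.normalized_posSemidef (P : POVM d Z) (ha : IsReference a) (z : Z) :
    (P.normalized a z).PosSemidef :=
  (P.reElem_posSemidef z).smul (inv_nonneg.2 (ha.frob_diagonal_nonneg (P.reElem_posSemidef z)))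

lemma POVM.trace_normalized_le (P : POVM d Z) (ha : IsReference a) (z : Z) :
    (P.normalized a z).trace ≤ 2 := by
  have h1 := ha.trace_le (P.reElem_posSemidef z)
  have h2 := ha.frob_diagonal_nonneg (P.reElem_posSemidef z)
  rw [POVM.normalized, Matrix.trace_smul, smul_eq_mul, inv_mul_eq_div]
  exact div_le_of_le_mul₀ h2 (by norm_num) h1

lemma POVM.prob_nullState_nonneg (P : POVM d Z) (ha : IsReference a) (z : Z) :
    0 ≤ P.prob (nullState a) z := by
  rw [P.prob_nullState]
  exact mul_nonneg (by positivity) (ha.frob_diagonal_nonneg (P.reElem_posSemidef z))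

lemma POVM.sum_prob_perturbedState (P : POVM d Z) (hd : 0 < d) (ha : IsReference a) (ε : ℝ)
    {M : Matrix (Fin d) (Fin d) ℝ} (hM : M.trace = 0) :
    ∑ z, P.prob (perturbedState a ε M) z = 1 := by
  have hd' : (d : ℝ) ≠ 0 := by positivity
  rw [perturbedState, P.sum_prob_map, Matrix.trace_smul, Matrix.trace_add, Matrix.trace_smul, hM,
    Matrix.trace_diagonal, ha.trace_eq]
  simp [hd']

lemma POVM.sum_prob_nullState (P : POVM d Z) (hd : 0 < d) (ha : IsReference a) :
    ∑ z, P.prob (nullState a) z = 1 := by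
  simpa [perturbedState, nullState] using
    P.sum_prob_perturbedState hd ha 0 (M := 0) (Matrix.trace_zero _ _)

lemma POVM.mean_normalized (P : POVM d Z) (ha : IsReference a)
    (v : Matrix (Fin d) (Fin d) ℝ) :
    ∑ z, P.prob (nullState a) z * frob v (P.normalized a z) = v.trace / d := by
  simp_rw [← frob_smul_right, P.prob_nullState_smul_normalized ha]
  rw [← frob_sum_right, ← Finset.smul_sum, P.sum_reElem, frob_smul_right, frob_one_right]
  ring

/-- Cauchy–Schwarz and trace at most `2` bound the square by `2⟨vᵀv, y⟩`, which is linear in `y`;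
the mean of `y` is `I/d`. -/
lemma POVM.covariance_normalized_le (P : POVM d Z) (ha : IsReference a)
    (v : Matrix (Fin d) (Fin d) ℝ) :
    ∑ z, P.prob (nullState a) z * frob v (P.normalized a z) ^ 2 ≤ 2 / d * frob v v := by
  have h : ∀ z, P.prob (nullState a) z * frob v (P.normalized a z) ^ 2 ≤
      2 * (P.prob (nullState a) z * frob (vᵀ * v) (P.normalized a z)) := by
    intro z
    have h1 := (P.normalized_posSemidef ha z).frob_sq_le_mul_trace v
    have h2 := P.trace_normalized_le ha z
    have h3 := P.prob_nullState_nonneg ha z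
    have h4 : 0 ≤ frob (vᵀ * v) (P.normalized a z) := by
      obtain ⟨C, hC⟩ := exists_transpose_mul_self (P.normalized_posSemidef ha z)
      rw [hC, frob_transpose_mul_self]
      refine Finset.sum_nonneg fun k _ => ?_
      rw [← Matrix.mulVec_mulVec, Matrix.dotProduct_mulVec, Matrix.vecMul_transpose]
      exact dotProduct_self_nonneg' _
    have h5 : frob v (P.normalized a z) ^ 2 ≤ 2 * frob (vᵀ * v) (P.normalized a z) := by nlinarith
    nlinarith
  refine (Finset.sum_le_sum fun z _ => h z).trans (le_of_eq ?_)
  rw [← Finset.mul_sum, P.mean_normalized ha, frob_eq_trace, Matrix.trace_mul_comm]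
  ring

/-- The conditional probabilities of the outcomes under the null hypothesis. -/
noncomputable def LearningTree.nullStep (T : LearningTree d n Z) (a : Fin d → ℝ) (t : Fin n)
    (h : Fin t → Z) (z : Z) : ℝ := (T.povm t h).prob (nullState a) z

/-- The normalized POVM elements on the edges of the tree. -/
noncomputable def LearningTree.edge (T : LearningTree d n Z) (a : Fin d → ℝ) (t : Fin n)
    (h : Fin t → Z) (z : Z) : Matrix (Fin d) (Fin d) ℝ := (T.povm t h).normalized a z

lemma LearningTree.isTreeMartingale (T : LearningTree d n Z) (hd : 0 < d) (ha : IsReference a) :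
    IsTreeMartingale (T.nullStep a) (fun t h z => center (T.edge a t h z)) (2 / d) where
  nonneg t h z := (T.povm t h).prob_nullState_nonneg ha z
  sum_eq_one t h := (T.povm t h).sum_prob_nullState hd ha
  mean_eq_zero t h v := by
    simp_rw [← frob_center_left]
    refine ((T.povm t h).mean_normalized ha (center v)).trans ?_
    rw [trace_center, zero_div]
  norm_le t h z := frob_center_center_le_four ((T.povm t h).normalized_posSemidef ha z)
    ((T.povm t h).trace_normalized_le ha z)
  covariance_le t h v := by
    simp_rw [← frob_center_left]
    refine ((T.povm t h).covariance_normalized_le ha (center v)).trans ?_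
    gcongr
    exact frob_center_self_le v

lemma LearningTree.leafProb_perturbedState (T : LearningTree d n Z) (ha : IsReference a) (ε : ℝ)
    (M : Matrix (Fin d) (Fin d) ℝ) (x : Fin n → Z) :
    T.leafProb (perturbedState a ε M) x =
      T.nullDist a x * ∏ t, (1 + ε * frob M (pathValue (T.edge a) x t)) := by
  rw [LearningTree.nullDist, LearningTree.leafProb, LearningTree.leafProb, ← Finset.prod_mul_distrib]
  exact Finset.prod_congr rfl fun t _ => (T.povm t _).prob_perturbedState ha ε M (x t)

lemma LearningTree.sum_leafProb_perturbedState (T : LearningTree d n Z) (hd : 0 < d)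
    (ha : IsReference a) (ε : ℝ) {M : Matrix (Fin d) (Fin d) ℝ} (hM : M.trace = 0) :
    ∑ x, T.leafProb (perturbedState a ε M) x = 1 :=
  sum_pathWeight_eq_one (fun t h z => (T.povm t h).prob (perturbedState a ε M) z)
    fun t h => (T.povm t h).sum_prob_perturbedState hd ha ε hM

end Povm

/-! ### The alternative distribution as a reweighting of the null one. -/

section AltDist

open Matrix

variable {d n : ℕ} {Z : Type} [Fintype Z] {a : Fin d → ℝ}

instance instBorelSpaceRealMatrix (d : ℕ) : BorelSpace (Matrix (Fin d) (Fin d) ℝ) :=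
  inferInstanceAs (BorelSpace (Fin d → Fin d → ℝ))

lemma measurableSet_truncationSet (d : ℕ) : MeasurableSet (truncationSet d) := by
  refine IsClosed.measurableSet ?_
  have h1 : Continuous fun M : Matrix (Fin d) (Fin d) ℝ =>
      Matrix.toEuclideanCLM (n := Fin d) (𝕜 := ℝ) M :=
    ((Matrix.toEuclideanCLM (n := Fin d) (𝕜 := ℝ)).toAlgEquiv.toLinearMap).continuous_of_finiteDimensional
  have h2 : Continuous fun M : Matrix (Fin d) (Fin d) ℝ => ∑ i, ∑ j, M i j ^ 2 :=
    continuous_finsetSum _ fun i _ => continuous_finsetSum _ fun j _ =>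
      (continuous_id.matrix_elem i j).pow 2
  rw [truncationSet, Set.ofPred_and]
  exact (isClosed_le h1.norm continuous_const).inter (isClosed_le continuous_const h2)

lemma goeStar_eq_map (d : ℕ) : goeStar d = (goeEntries d).map goeMat := by
  rw [goeStar]
  change Measure.map center ((goeEntries d).map symMat) = _
  rw [Measure.map_map continuous_center.measurable continuous_symMat.measurable]
  rfl

lemma integral_truncatedGoeStar {f : Matrix (Fin d) (Fin d) ℝ → ℝ} (hf : Measurable f) :
    ∫ M, f M ∂(truncatedGoeStar d) =
      ((goeEntries d).real (truncatedEntries d))⁻¹ *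
        ∫ g in truncatedEntries d, f (goeMat g) ∂(goeEntries d) := by
  have hpre : goeMat ⁻¹' truncationSet d = truncatedEntries d :=
    Set.ext fun g => goeMat_mem_truncationSet_iff g
  have hm := continuous_goeMat (d := d).measurable
  rw [truncatedGoeStar, ProbabilityTheory.cond, integral_smul_measure, goeStar_eq_map,
    Measure.map_apply hm (measurableSet_truncationSet d),
    Measure.restrict_map hm (measurableSet_truncationSet d), hpre,
    integral_map hm.aemeasurable hf.aestronglyMeasurable, ENNReal.toReal_inv]
  rfl

/-- The likelihood ratio of a leaf, when the random state is given by the entries `g`. -/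
noncomputable def LearningTree.likelihood (T : LearningTree d n Z) (a : Fin d → ℝ) (ε : ℝ)
    (x : Fin n → Z) (g : Sym2 (Fin d) → ℝ) : ℝ :=
  ∏ t, (1 + ε * frob (goeMat g) (pathValue (T.edge a) x t))

lemma LearningTree.continuous_likelihood (T : LearningTree d n Z) (a : Fin d → ℝ) (ε : ℝ)
    (x : Fin n → Z) : Continuous (T.likelihood a ε x) :=
  continuous_finsetProd _ fun _ _ => continuous_const.add (continuous_const.mul
    (continuous_frob.comp (continuous_goeMat.prodMk continuous_const)))

lemma LearningTree.abs_step_le (T : LearningTree d n Z) (ha : IsReference a) {ε : ℝ} (hε : 0 < ε)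
    (hε' : ε ≤ 1 / 12) (x : Fin n → Z) {g : Sym2 (Fin d) → ℝ} (hg : g ∈ truncatedEntries d)
    (t : Fin n) : |ε * frob (goeMat g) (pathValue (T.edge a) x t)| ≤ 1 / 2 := by
  have h1 := ((T.povm t (pathHistory x t)).normalized_posSemidef ha (x t)).abs_frob_le hg.1
  have h2 := (T.povm t (pathHistory x t)).trace_normalized_le ha (x t)
  have h3 : |frob (goeMat g) (pathValue (T.edge a) x t)| ≤ 6 := h1.trans (by linarith)
  rw [abs_mul, abs_of_pos hε]
  calc ε * |frob (goeMat g) (pathValue (T.edge a) x t)| ≤ 1 / 12 * 6 :=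
        mul_le_mul hε' h3 (abs_nonneg _) (by norm_num)
    _ = _ := by norm_num

lemma LearningTree.likelihood_nonneg (T : LearningTree d n Z) (ha : IsReference a) {ε : ℝ}
    (hε : 0 < ε) (hε' : ε ≤ 1 / 12) (x : Fin n → Z) {g : Sym2 (Fin d) → ℝ}
    (hg : g ∈ truncatedEntries d) : 0 ≤ T.likelihood a ε x g :=
  Finset.prod_nonneg fun t _ => by linarith [(abs_le.1 (T.abs_step_le ha hε hε' x hg t)).1]

lemma LearningTree.integrableOn_likelihood (T : LearningTree d n Z) (ha : IsReference a) {ε : ℝ}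
    (hε : 0 < ε) (hε' : ε ≤ 1 / 12) (x : Fin n → Z) :
    IntegrableOn (T.likelihood a ε x) (truncatedEntries d) (goeEntries d) := by
  refine Integrable.of_bound (T.continuous_likelihood a ε x).aestronglyMeasurable ((3 / 2) ^ n) ?_
  refine (ae_restrict_iff' (measurableSet_truncatedEntries d)).2
    (Filter.Eventually.of_forall fun g hg => ?_)
  rw [LearningTree.likelihood, Real.norm_eq_abs, Finset.abs_prod]
  calc _ ≤ ∏ _t : Fin n, (3 / 2 : ℝ) := Finset.prod_le_prod (fun _ _ => abs_nonneg _) fun t _ => by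
        have := T.abs_step_le ha hε hε' x hg t
        exact (abs_add_le _ _).trans (by rw [abs_one]; linarith)
    _ = _ := by rw [Finset.prod_const, Finset.card_univ, Fintype.card_fin]

/-- The averaged likelihood ratio of a leaf. -/
noncomputable def LearningTree.meanLikelihood (T : LearningTree d n Z) (a : Fin d → ℝ) (ε : ℝ)
    (x : Fin n → Z) : ℝ :=
  ((goeEntries d).real (truncatedEntries d))⁻¹ *
    ∫ g in truncatedEntries d, T.likelihood a ε x g ∂(goeEntries d)

lemma LearningTree.altDist_eq (T : LearningTree d n Z) (ha : IsReference a) (ε : ℝ)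
    (x : Fin n → Z) : T.altDist a ε x = T.nullDist a x * T.meanLikelihood a ε x := by
  rw [LearningTree.altDist]
  simp_rw [T.leafProb_perturbedState ha]
  rw [integral_const_mul, integral_truncatedGoeStar, LearningTree.meanLikelihood]
  · rfl
  · refine Continuous.measurable ?_
    exact continuous_finsetProd _ fun _ _ => continuous_const.add (continuous_const.mul
      (continuous_frob.comp (continuous_id.prodMk continuous_const)))

lemma LearningTree.sum_altDist (T : LearningTree d n Z) (hd : 0 < d) (ha : IsReference a) {ε : ℝ}
    (hε : 0 < ε) (hε' : ε ≤ 1 / 12) (hU : (goeEntries d).real (truncatedEntries d) ≠ 0) :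
    ∑ x, T.altDist a ε x = 1 := by
  simp_rw [T.altDist_eq ha, LearningTree.meanLikelihood, mul_left_comm (T.nullDist a _),
    ← integral_const_mul (T.nullDist a _)]
  rw [← Finset.mul_sum, ← integral_finsetSum _ fun x _ =>
    (T.integrableOn_likelihood ha hε hε' x).const_mul _]
  have h : ∀ g : Sym2 (Fin d) → ℝ, ∑ x, T.nullDist a x * T.likelihood a ε x g = 1 := fun g => by
    rw [← T.sum_leafProb_perturbedState hd ha ε (trace_goeMat g)]
    exact Finset.sum_congr rfl fun x _ => (T.leafProb_perturbedState ha ε (goeMat g) x).symm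
  simp_rw [h]
  simp [hU]

lemma LearningTree.meanLikelihood_nonneg (T : LearningTree d n Z) (ha : IsReference a) {ε : ℝ}
    (hε : 0 < ε) (hε' : ε ≤ 1 / 12) (x : Fin n → Z) : 0 ≤ T.meanLikelihood a ε x :=
  mul_nonneg (by positivity) (setIntegral_nonneg (measurableSet_truncatedEntries d)
    fun _ hg => T.likelihood_nonneg ha hε hε' x hg)

/-- The normalizing probability is at most `1`, so dividing by it only helps; `0 < b` rules out that
it vanishes. -/
lemma LearningTree.le_meanLikelihood (T : LearningTree d n Z) (ha : IsReference a) {ε : ℝ}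
    (hε : 0 < ε) (hε' : ε ≤ 1 / 12) (x : Fin n → Z) {b : ℝ} (hb : 0 < b)
    (h : ENNReal.ofReal b ≤ ∫⁻ g in truncatedEntries d, ENNReal.ofReal (T.likelihood a ε x g)
      ∂(goeEntries d)) : b ≤ T.meanLikelihood a ε x := by
  rw [← ofReal_integral_eq_lintegral_ofReal (T.integrableOn_likelihood ha hε hε' x)
    ((ae_restrict_iff' (measurableSet_truncatedEntries d)).2
      (Filter.Eventually.of_forall fun g hg => T.likelihood_nonneg ha hε hε' x hg))] at h
  have h1 : b ≤ ∫ g in truncatedEntries d, T.likelihood a ε x g ∂(goeEntries d) :=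
    (ENNReal.ofReal_le_ofReal_iff'.1 h).resolve_right (not_le.2 hb)
  have hU : (goeEntries d).real (truncatedEntries d) ≠ 0 := fun h0 => by
    have : goeEntries d (truncatedEntries d) = 0 := (measureReal_eq_zero_iff).1 h0
    rw [Measure.restrict_eq_zero.2 this] at h1
    simp at h1; linarith
  have hU1 : (goeEntries d).real (truncatedEntries d) ≤ 1 := measureReal_le_one
  have hU0 : 0 < (goeEntries d).real (truncatedEntries d) := lt_of_le_of_ne measureReal_nonneg hU.symm
  have h2 := one_le_inv₀ hU0 |>.2 hU1
  rw [LearningTree.meanLikelihood]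
  nlinarith

end AltDist

/-! ### Total variation bound and choice of constants. -/

section TotalVariation

variable {d n : ℕ} {Z : Type} [Fintype Z] {a : Fin d → ℝ}

/-- Equal total masses make the distance equal to the mean of the positive part of `1 - L`; a
one-sided bound on `L` suffices. -/
lemma tvDist_mul_le {S : Type} [Fintype S] (p L b : S → ℝ) (hp : ∀ x, 0 ≤ p x)
    (hp1 : ∑ x, p x = 1) (hL1 : ∑ x, p x * L x = 1) (hb0 : ∀ x, 0 ≤ b x)
    (hb : ∀ x, 1 - L x ≤ b x) : tvDist p (fun x => p x * L x) ≤ ∑ x, p x * b x := by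
  have h : ∀ x, |p x - p x * L x| ≤ 2 * (p x * b x) - (p x - p x * L x) := by
    intro x
    have h1 := mul_le_mul_of_nonneg_left (hb x) (hp x)
    have h2 := mul_nonneg (hp x) (hb0 x)
    rw [abs_le]; constructor <;> linarith
  have h2 := Finset.sum_le_sum fun x (_ : x ∈ Finset.univ) => h x
  rw [Finset.sum_sub_distrib, Finset.sum_sub_distrib, ← Finset.mul_sum, hp1, hL1] at h2
  rw [tvDist]; linarith

/-- Upper bound for the deficit of the averaged likelihood ratio of a leaf. -/
lemma LearningTree.one_sub_meanLikelihood_le (T : LearningTree d n Z) (hd : 0 < d)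
    (ha : IsReference a) {ε : ℝ} (hε : 0 < ε) (hε' : ε ≤ 1 / 12) (x : Fin n → Z)
    {S : Matrix (Fin d) (Fin d) ℝ}
    (hS : S = ∑ t, pathValue (fun t h z => center (T.edge a t h z)) x t) {v : ℝ}
    (hv : v = (goeEntries d).real (typicalSet d)) (hv0 : 0 < v) :
    1 - T.meanLikelihood a ε x ≤ (1 - v) +
      ε ^ 2 / d * |frob S S - ∑ t, frob (pathValue (fun t h z => center (T.edge a t h z)) x t)
        (pathValue (fun t h z => center (T.edge a t h z)) x t)| +
      ε ^ 2 / d * (1 - v) * (4 * n) +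
      ε ^ 2 * (2 * ε / d) ^ 2 *
        ∑ t, frob S (pathValue (fun t h z => center (T.edge a t h z)) x t) ^ 2 +
      20512 * (n * ε ^ 3 / (d * Real.sqrt d)) + 100 * (2 * ε / d) ^ 2 * frob S S := by
  set c : Fin n → Matrix (Fin d) (Fin d) ℝ :=
    fun t => pathValue (fun t h z => center (T.edge a t h z)) x t with hc
  have hv1 : v ≤ 1 := hv ▸ measureReal_le_one
  have hSS := frob_self_nonneg S
  have hW : 0 ≤ ∑ t, frob S (c t) ^ 2 := Finset.sum_nonneg fun t _ => sq_nonneg _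
  have h0 := T.meanLikelihood_nonneg ha hε hε' x
  have h1v : 0 ≤ 1 - v := by linarith
  have t2 : 0 ≤ ε ^ 2 / d * |frob S S - ∑ t, frob (c t) (c t)| := by positivity
  have t3 : 0 ≤ ε ^ 2 / d * (1 - v) * (4 * n) := by positivity
  have t4 : 0 ≤ ε ^ 2 * (2 * ε / d) ^ 2 * ∑ t, frob S (c t) ^ 2 := by positivity
  have t5 : 0 ≤ 20512 * (n * ε ^ 3 / (d * Real.sqrt d)) := by positivity
  have t6 : 0 ≤ 100 * (2 * ε / d) ^ 2 * frob S S := by positivity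
  -- If `S` is too long for the translation, the last term of the bound is already at least `1`.
  by_cases hSn : (2 * ε / d) ^ 2 * frob S S ≤ 1 / 100
  · set Φ := ε ^ 2 / d * (frob S S - v⁻¹ * ∑ t, frob (c t) (c t))
      - ε ^ 2 * (2 * ε / d) ^ 2 * ∑ t, frob S (c t) ^ 2
      - 20512 * (n * ε ^ 3 / (d * Real.sqrt d)) * v⁻¹ with hΦ
    have hlow : v * Real.exp Φ ≤ T.meanLikelihood a ε x := by
      refine T.le_meanLikelihood ha hε hε' x (by positivity) ?_
      exact le_lintegral_likelihood hd hε.le hε' (fun t => pathValue (T.edge a) x t)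
        (fun t => (T.povm t _).normalized_posSemidef ha _)
        (fun t => (T.povm t _).trace_normalized_le ha _) hS hv hv0 hSn
    have hexp : v * (1 + Φ) ≤ v * Real.exp Φ := by
      gcongr; linarith [Real.add_one_le_exp Φ]
    -- The factor `v⁻¹` on the diagonal sum cancels, and replacing `‖S‖²` by `v‖S‖²` leaves the
    -- mismatch `(1 - v) ∑ ‖c_t‖²`.
    have hvΦ : v * Φ = ε ^ 2 / d * (v * (frob S S - ∑ t, frob (c t) (c t))) -
        ε ^ 2 / d * (1 - v) * (∑ t, frob (c t) (c t)) -
        v * (ε ^ 2 * (2 * ε / d) ^ 2 * ∑ t, frob S (c t) ^ 2) -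
        20512 * (n * ε ^ 3 / (d * Real.sqrt d)) := by
      rw [hΦ]; field_simp; ring
    have e2 : -(ε ^ 2 / d * |frob S S - ∑ t, frob (c t) (c t)|) ≤
        ε ^ 2 / d * (v * (frob S S - ∑ t, frob (c t) (c t))) := by
      rw [← mul_neg]
      gcongr
      have := neg_abs_le (frob S S - ∑ t, frob (c t) (c t))
      nlinarith [abs_nonneg (frob S S - ∑ t, frob (c t) (c t))]
    have hQ : ∑ t, frob (c t) (c t) ≤ 4 * n := by
      calc _ ≤ ∑ _t : Fin n, (4 : ℝ) := Finset.sum_le_sum fun t _ =>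
            (T.isTreeMartingale hd ha).norm_le _ _ _
        _ = _ := by
            rw [Finset.sum_const, Finset.card_univ, Fintype.card_fin, nsmul_eq_mul, mul_comm]
    have e3 : ε ^ 2 / d * (1 - v) * (∑ t, frob (c t) (c t)) ≤
        ε ^ 2 / d * (1 - v) * (4 * n) := by gcongr
    have e4 := mul_le_mul_of_nonneg_right hv1 t4
    linarith
  · have : 1 ≤ 100 * (2 * ε / d) ^ 2 * frob S S := by linarith
    linarith

/-- In terms of `k = n ε² / d^{3/2} ≤ c`, every error is a multiple of `k²/c`, `k²`, `k/√d` or `kε`,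
apart from `c/2` and the atypical probability. -/
lemma error_budget_le {d n ε c K v ER EW ES : ℝ} (hd1 : 1 ≤ d) (hε : 0 < ε) (hε' : ε ≤ 1 / 12)
    (hc : 0 < c) (hc1 : c ≤ 1) (hn0 : 0 ≤ n) (hn : n * ε ^ 2 / (d * Real.sqrt d) ≤ c)
    (hK0 : 0 ≤ K) (hK : 1 - v ≤ K / d) (hER : ER ≤ 8 * (2 / d) * n ^ 2)
    (hEW : EW ≤ 6 * (2 / d) * n ^ 2 + 32 * n) (hES : ES ≤ 4 * n) :
    (1 - v) + ε ^ 2 / d * (1 - v) * (4 * n) + 20512 * (n * ε ^ 3 / (d * Real.sqrt d)) + c / 2 +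
      (ε ^ 2 / d) ^ 2 / (2 * c) * ER + ε ^ 2 * (2 * ε / d) ^ 2 * EW +
      100 * (2 * ε / d) ^ 2 * ES ≤ K / d + (4 * K + 4000) * c := by
  have hd' : 0 < d := by linarith
  set r := Real.sqrt d with hr
  have hr0 : 0 < r := Real.sqrt_pos.2 hd'
  have hrr : d = r ^ 2 := (Real.sq_sqrt hd'.le).symm
  have hr1 : 1 ≤ r := Real.one_le_sqrt.2 hd1
  clear_value r
  subst hrr
  obtain ⟨k, hk⟩ : ∃ k, k = n * ε ^ 2 / (r ^ 2 * r) := ⟨_, rfl⟩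
  rw [← hk] at hn
  have hk0 : 0 ≤ k := by rw [hk]; positivity
  have hnk : n = k * (r ^ 3 / ε ^ 2) := by
    rw [hk]; field_simp
  have b1 : (ε ^ 2 / r ^ 2) ^ 2 / (2 * c) * ER ≤ 8 * c := by
    calc _ ≤ (ε ^ 2 / r ^ 2) ^ 2 / (2 * c) * (8 * (2 / r ^ 2) * n ^ 2) := by gcongr
      _ = 8 * (k * k) / c := by rw [hnk]; field_simp
      _ ≤ 8 * (c * c) / c := by gcongr
      _ = 8 * c := by field_simp
  have b2 : ε ^ 2 * (2 * ε / r ^ 2) ^ 2 * EW ≤ 49 * c := by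
    calc _ ≤ ε ^ 2 * (2 * ε / r ^ 2) ^ 2 * (6 * (2 / r ^ 2) * n ^ 2 + 32 * n) := by gcongr
      _ = 48 * (k * k) + 128 * ε ^ 2 * (k / r) := by rw [hnk]; field_simp; ring
      _ ≤ 48 * (c * 1) + 128 * (1 / 12) ^ 2 * (c / 1) := by
          gcongr; exact hn.trans hc1
      _ ≤ 49 * c := by linarith
  have b3 : 100 * (2 * ε / r ^ 2) ^ 2 * ES ≤ 1600 * c := by
    calc _ ≤ 100 * (2 * ε / r ^ 2) ^ 2 * (4 * n) := by gcongr
      _ = 1600 * (k / r) := by rw [hnk]; field_simp; ring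
      _ ≤ 1600 * (c / 1) := by gcongr
      _ = _ := by ring
  have b4 : ε ^ 2 / r ^ 2 * (1 - v) * (4 * n) ≤ 4 * K * c := by
    calc _ ≤ ε ^ 2 / r ^ 2 * (K / r ^ 2) * (4 * n) := by gcongr
      _ = 4 * K * (k / r) := by rw [hnk]; field_simp
      _ ≤ 4 * K * (c / 1) := by gcongr
      _ = _ := by ring
  have b5 : 20512 * (n * ε ^ 3 / (r ^ 2 * r)) ≤ 1710 * c := by
    calc _ = 20512 * (k * ε) := by rw [hk]; ring
      _ ≤ 20512 * (c * (1 / 12)) := by gcongr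
      _ ≤ _ := by linarith
  linarith

/-- The total variation distance, in terms of `n ε² / d^{3/2}` and the probability of atypical
matrices. -/
lemma LearningTree.tvDist_le (T : LearningTree d n Z) (hd : 0 < d) (ha : IsReference a) {ε : ℝ}
    (hε : 0 < ε) (hε' : ε ≤ 1 / 12) {v : ℝ} (hv : v = (goeEntries d).real (typicalSet d))
    (hv0 : 0 < v) {K : ℝ} (hK : 1 - v ≤ K / d) {c : ℝ} (hc : 0 < c) (hc1 : c ≤ 1)
    (hn : n * ε ^ 2 / (d * Real.sqrt d) ≤ c) :
    tvDist (T.nullDist a) (T.altDist a ε) ≤ K / d + (4 * K + 4000) * c := by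
  have hd' : (0 : ℝ) < d := by positivity
  have hd1 : (1 : ℝ) ≤ d := by exact_mod_cast hd
  have hv1 : v ≤ 1 := hv ▸ measureReal_le_one
  have hK0 : 0 ≤ K := by
    by_contra! h
    linarith [div_neg_of_neg_of_pos h hd']
  have hm := T.isTreeMartingale hd ha
  set Y : (t : Fin n) → (Fin t → Z) → Z → Matrix (Fin d) (Fin d) ℝ :=
    fun t h z => center (T.edge a t h z) with hY
  set p := pathWeight (T.nullStep a) with hp
  set S : (Fin n → Z) → Matrix (Fin d) (Fin d) ℝ := fun x => ∑ t, pathValue Y x t with hS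
  set R : (Fin n → Z) → ℝ := fun x =>
    frob (S x) (S x) - ∑ t, frob (pathValue Y x t) (pathValue Y x t) with hR
  set W : (Fin n → Z) → ℝ := fun x => ∑ t, frob (S x) (pathValue Y x t) ^ 2 with hW
  have hp1 : ∑ x, p x = 1 := hm.sum_pathWeight
  have hES : ∑ x, p x * frob (S x) (S x) ≤ 4 * n := hm.mean_normSq_le
  have hER : ∑ x, p x * R x ^ 2 ≤ 8 * (2 / d) * n ^ 2 := hm.mean_crossTerm_sq_le (by positivity)
  have hEW : ∑ x, p x * W x ≤ 6 * (2 / d) * n ^ 2 + 32 * n := hm.mean_sum_frob_sq_le (by positivity)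
  have hU : (goeEntries d).real (truncatedEntries d) ≠ 0 := by
    have : v ≤ (goeEntries d).real (truncatedEntries d) :=
      hv ▸ measureReal_mono (typicalSet_subset_truncatedEntries d)
    linarith
  set D := (1 - v) + ε ^ 2 / d * (1 - v) * (4 * n) + 20512 * (n * ε ^ 3 / (d * Real.sqrt d)) + c / 2 with hD
  set b : (Fin n → Z) → ℝ := fun x => D + (ε ^ 2 / d) ^ 2 / (2 * c) * R x ^ 2 +
    ε ^ 2 * (2 * ε / d) ^ 2 * W x + 100 * (2 * ε / d) ^ 2 * frob (S x) (S x) with hb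
  have hbound : ∀ x, 1 - T.meanLikelihood a ε x ≤ b x := by
    intro x
    refine (T.one_sub_meanLikelihood_le hd ha hε hε' x (S := S x) rfl hv hv0).trans ?_
    -- AM–GM with weight `c`: the mean of the squared term is `O(k²/c)`, hence also `O(c)`.
    have h : ε ^ 2 / d * |R x| ≤ c / 2 + (ε ^ 2 / d) ^ 2 / (2 * c) * R x ^ 2 := by
      have h1 : c / 2 + (ε ^ 2 / d) ^ 2 / (2 * c) * R x ^ 2 - ε ^ 2 / d * |R x| =
          (c - ε ^ 2 / d * |R x|) ^ 2 / (2 * c) := by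
        rw [← sq_abs (R x)]; field_simp; ring
      have : 0 ≤ (c - ε ^ 2 / d * |R x|) ^ 2 / (2 * c) := by positivity
      linarith
    simp only [hb, hD, hR, hW] at h ⊢
    linarith
  have hb0 : ∀ x, 0 ≤ b x := by
    intro x
    have h1 : 0 ≤ 1 - v := by linarith
    have h2 : 0 ≤ W x := Finset.sum_nonneg fun t _ => sq_nonneg _
    have h3 := frob_self_nonneg (S x)
    simp only [hb, hD]
    positivity
  have halt : T.altDist a ε = fun x => p x * T.meanLikelihood a ε x :=
    funext fun x => T.altDist_eq ha ε x
  have hL1 := T.sum_altDist hd ha hε hε' hU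
  rw [halt] at hL1 ⊢
  refine (tvDist_mul_le p (T.meanLikelihood a ε) b hm.pathWeight_nonneg hp1 hL1 hb0 hbound).trans ?_
  have hsum : ∑ x, p x * b x = D + (ε ^ 2 / d) ^ 2 / (2 * c) * ∑ x, p x * R x ^ 2 +
      ε ^ 2 * (2 * ε / d) ^ 2 * ∑ x, p x * W x +
      100 * (2 * ε / d) ^ 2 * ∑ x, p x * frob (S x) (S x) := by
    simp only [hb, mul_add, Finset.sum_add_distrib, ← Finset.sum_mul, hp1, one_mul,
      mul_left_comm (p _), ← Finset.mul_sum]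
  rw [hsum]
  exact error_budget_le hd1 hε hε' hc hc1 (Nat.cast_nonneg n) hn hK0 hK hER hEW hES

lemma LearningTree.sum_nullDist (T : LearningTree d n Z) (hd : 0 < d) (ha : IsReference a) :
    ∑ x, T.nullDist a x = 1 := (T.isTreeMartingale hd ha).sum_pathWeight

lemma one_sub_typicalConst_div_le (hd : 4 ≤ d) :
    1 - (goeEntries d).real (typicalSet d) ≤ typicalConst / d := by
  rw [← probReal_compl_eq_one_sub (measurableSet_typicalSet d)]
  exact measure_typicalSet_compl_le hd

lemma half_le_measure_typicalSet (hd : 4 ≤ d) (h : 2 * typicalConst ≤ d) :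
    1 / 2 ≤ (goeEntries d).real (typicalSet d) := by
  have hd' : (0 : ℝ) < d := by positivity
  have h1 := one_sub_typicalConst_div_le hd
  have h2 : typicalConst / d ≤ 1 / 2 := by rw [div_le_iff₀ hd']; linarith
  linarith

/-- The two success probabilities sum to at most `1` plus the distance, and to at least `4/3`. -/
lemma LearningTree.Distinguishes.third_le_tvDist {T : LearningTree d n Z} {ε : ℝ}
    {φ : (Fin n → Z) → ℝ} (h : T.Distinguishes a ε φ) (h0 : ∑ x, T.nullDist a x = 1)
    (h1 : ∑ x, T.altDist a ε x = 1) : 1 / 3 ≤ tvDist (T.nullDist a) (T.altDist a ε) := by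
  obtain ⟨hφ, h2, h3⟩ := h
  have hle : ∀ x, T.altDist a ε x * φ x + T.nullDist a x * (1 - φ x) ≤
      1 / 2 * |T.nullDist a x - T.altDist a ε x| +
        1 / 2 * (T.nullDist a x + T.altDist a ε x) := by
    intro x
    obtain ⟨ha, hb⟩ := hφ x
    rcases abs_cases (T.nullDist a x - T.altDist a ε x) with ⟨he, _⟩ | ⟨he, _⟩ <;> rw [he] <;>
      nlinarith
  have := Finset.sum_le_sum fun x (_ : x ∈ Finset.univ) => hle x
  rw [Finset.sum_add_distrib, Finset.sum_add_distrib, ← Finset.mul_sum, ← Finset.mul_sum,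
    Finset.sum_add_distrib, h0, h1] at this
  rw [tvDist]
  linarith

lemma exists_tvDist_le (δ : ℝ) (hδ : 0 < δ) : ∃ c : ℝ, 0 < c ∧ ∃ d₀ : ℕ, ∀ d : ℕ, d₀ ≤ d →
    ∀ ε : ℝ, 0 < ε → ε ≤ 1 / 12 → ∀ a : Fin d → ℝ, IsReference a →
    ∀ (Z : Type) [Fintype Z] (n : ℕ) (T : LearningTree d n Z),
      (n : ℝ) ≤ c * ((d : ℝ) ^ (3 / 2 : ℝ) / ε ^ 2) →
      ∑ x, T.nullDist a x = 1 ∧ ∑ x, T.altDist a ε x = 1 ∧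
        tvDist (T.nullDist a) (T.altDist a ε) ≤ δ := by
  have hC := typicalConst_pos
  set C := typicalConst
  -- The choice of `c` makes the part proportional to `c` at most `δ/2`. For `d`, `4` serves the
  -- Chebyshev bound, `2C` makes the typical set have probability at least `1/2`, and `2C/δ` makes
  -- `C/d` at most `δ/2`.
  refine ⟨min 1 (δ / (2 * (4 * C + 4000))), by positivity, ⌈max 4 (max (2 * C) (2 * C / δ))⌉₊,
    fun d hd ε hε hε' a ha Z _ n T hn => ?_⟩
  set c := min 1 (δ / (2 * (4 * C + 4000))) with hc
  have hc0 : 0 < c := by positivity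
  have hdR := Nat.ceil_le.1 hd
  simp only [max_le_iff] at hdR
  obtain ⟨hd4, hd2, hdδ⟩ := hdR
  have hd4' : 4 ≤ d := by exact_mod_cast hd4
  have hd0 : 0 < d := by omega
  have hd' : (0 : ℝ) < d := by positivity
  have hv := half_le_measure_typicalSet hd4' hd2
  have hU : (goeEntries d).real (truncatedEntries d) ≠ 0 := by
    have : (goeEntries d).real (typicalSet d) ≤ (goeEntries d).real (truncatedEntries d) :=
      measureReal_mono (typicalSet_subset_truncatedEntries d)
    linarith
  refine ⟨T.sum_nullDist hd0 ha, T.sum_altDist hd0 ha hε hε' hU, ?_⟩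
  have hpow : (d : ℝ) ^ (3 / 2 : ℝ) = d * Real.sqrt d := by
    rw [Real.sqrt_eq_rpow, ← Real.rpow_one_add' hd'.le (by norm_num)]; norm_num
  have hk : n * ε ^ 2 / (d * Real.sqrt d) ≤ c := by
    have : 0 < Real.sqrt d := Real.sqrt_pos.2 hd'
    rw [hpow, ← mul_div_assoc, le_div_iff₀ (by positivity)] at hn
    rwa [div_le_iff₀ (by positivity)]
  refine (T.tvDist_le hd0 ha hε hε' rfl (by linarith) (one_sub_typicalConst_div_le hd4') hc0
    (min_le_left _ _) hk).trans ?_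
  have h1 : C / d ≤ δ / 2 := by
    rw [div_le_iff₀ hδ] at hdδ
    rw [div_le_iff₀ hd']; linarith
  have h2 : (4 * C + 4000) * c ≤ δ / 2 := by
    calc (4 * C + 4000) * c ≤ (4 * C + 4000) * (δ / (2 * (4 * C + 4000))) := by
          gcongr; exact min_le_right _ _
      _ = δ / 2 := by field_simp
  linarith

end TotalVariation

theorem mainTheorem2 :
    (∃ c : ℝ, 0 < c ∧ ∃ d₀ : ℕ, ∀ d : ℕ, d₀ ≤ d →
      ∀ ε : ℝ, 0 < ε → ε ≤ 1 / 12 →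
      ∀ a : Fin d → ℝ, IsReference a →
      ∀ (Z : Type) [Fintype Z] (n : ℕ) (T : LearningTree d n Z)
        (φ : (Fin n → Z) → ℝ),
        T.Distinguishes a ε φ → c * ((d : ℝ) ^ (3 / 2 : ℝ) / ε ^ 2) ≤ (n : ℝ)) ∧
    (∀ δ : ℝ, 0 < δ → ∃ c : ℝ, 0 < c ∧ ∃ d₀ : ℕ, ∀ d : ℕ, d₀ ≤ d →
      ∀ ε : ℝ, 0 < ε → ε ≤ 1 / 12 →
      ∀ a : Fin d → ℝ, IsReference a →
      ∀ (Z : Type) [Fintype Z] (n : ℕ) (T : LearningTree d n Z),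
        (n : ℝ) ≤ c * ((d : ℝ) ^ (3 / 2 : ℝ) / ε ^ 2) →
        tvDist (T.nullDist a) (T.altDist a ε) ≤ δ) := by
  constructor
  -- Any `δ < 1/3` contradicts the success probabilities.
  · obtain ⟨c, hc, d₀, h⟩ := exists_tvDist_le (1 / 4) (by norm_num)
    refine ⟨c, hc, d₀, fun d hd ε hε hε' a ha Z _ n T φ hφ => ?_⟩
    by_contra! hn
    obtain ⟨h0, h1, h2⟩ := h d hd ε hε hε' a ha Z n T hn.le
    linarith [hφ.third_le_tvDist h0 h1]
  · intro δ hδ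
    obtain ⟨c, hc, d₀, h⟩ := exists_tvDist_le δ hδ
    exact ⟨c, hc, d₀, fun d hd ε hε hε' a ha Z _ n T hn => (h d hd ε hε hε' a ha Z n T hn).2.2⟩
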